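/- Let $n\ge 0$ be an integer, let $\Omega\subseteq\mathbb R^n$ be a non-empty convex open set, and let $F$ be a Finsler metric on $\Omega$: a function $F(x,y)$ of $x\in\Omega$, $y\in\mathbb R^n$ that is $C^\infty$ and positive where $y\neq 0$, satisfies $F(x,ay)=aF(x,y)$ for $a>0$, and has positive definite fundamental tensor $g_{ij}=\frac12\,\partial^2F^2/\partial y^i\partial y^j$ for $y\ne0$. Suppose that $(\Omega,F)$ is spherically symmetric: $A\Omega=\Omega$ and $F(Ax,Ay)=F(x,y)$ for all $A\in O(n)$. Call $F$ projective if its geodesics are straight lines, i.e. if every geodesic (a $C^2$ curve $c$ in $\Omega$ on an open interval, with $c'\neq0$, that satisfies the Euler–Lagrange equations of the energy $\frac12F^2$) is contained in a straight line. Write $r=|x|$, $u=|y|$, $v=\langle x,y\rangle$. 1. $F$ is projective if and only if there are a positive smooth function $f$ on $\{-|x|^2:x\in\Omega\}$ and a smooth function $g$ on $\{|x|:x\in\Omega\}$ such that, for all $x\in\Omega$ and $y\neq0$, $$F(x,y)=\phi(|x|,|y|,\langle x,y\rangle),\qquad \phi(r,u,v)=\int f\Big(\frac{v^2}{u^2}-r^2\Big)\,du+g(r)\,v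 ,$$ where $\int f\,du$ denotes some antiderivative in the variable $u$ (for fixed $r$ and $v$), i.e. a function $\Phi(r,u,v)$ on $\{(r,u,v): r\in\{|x|:x\in\Omega\},\ u>0,\ |v|\le ru\}$ with $\partial\Phi/\partial u=f(v^2/u^2-r^2)$ (a one-sided derivative at the end point $u=|v|/r$ if $v\ne0$). 2. If $n\ge2$, the same equivalence holds with the antiderivative $$\int f\Big(\frac{v^2}{u^2}-r^2\Big)du:=f(-r^2)\,u-\int_u^\infty\Big(f\Big(\frac{v^2}{w^2}-r^2\Big)-f(-r^2)\Big)\,dw .$$ (Smoothness on a set containing a boundary point, such as $[0,R)$, is understood one-sidedly there.) -/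

import Mathlib

open scoped ContDiff

/-- The energy `F² / 2` of a function `F` of a point `x` and a tangent vector `y`. -/
noncomputable def finslerEnergy {n : ℕ}
    (F : EuclideanSpace ℝ (Fin n) → EuclideanSpace ℝ (Fin n) → ℝ)
    (x y : EuclideanSpace ℝ (Fin n)) : ℝ :=
  F x y ^ 2 / 2

/-- `F` is a (smooth, positively homogeneous, strongly convex) Finsler metric on `Ω ⊆ ℝⁿ`.
The bilinear form in `posDef` is the fundamental tensor
`g_ij(x, y) = (1/2) ∂²F² / ∂yⁱ∂yʲ`. -/
structure IsFinslerMetricOn {n : ℕ} (Ω : Set (EuclideanSpace ℝ (Fin n)))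
    (F : EuclideanSpace ℝ (Fin n) → EuclideanSpace ℝ (Fin n) → ℝ) : Prop where
  smooth : ContDiffOn ℝ ∞
    (fun p : EuclideanSpace ℝ (Fin n) × EuclideanSpace ℝ (Fin n) => F p.1 p.2) (Ω ×ˢ {0}ᶜ)
  pos : ∀ x ∈ Ω, ∀ y, y ≠ 0 → 0 < F x y
  homogeneous : ∀ x ∈ Ω, ∀ y, ∀ a : ℝ, 0 < a → F x (a • y) = a * F x y
  posDef : ∀ x ∈ Ω, ∀ y, y ≠ 0 → ∀ w, w ≠ 0 →
    0 < fderiv ℝ (fderiv ℝ (finslerEnergy F x)) y w w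

/-- `(Ω, F)` is spherically symmetric: every orthogonal transformation of `ℝⁿ` maps `Ω` onto
itself and is an isometry of `F`. -/
structure IsSphericallySymmetric {n : ℕ} (Ω : Set (EuclideanSpace ℝ (Fin n)))
    (F : EuclideanSpace ℝ (Fin n) → EuclideanSpace ℝ (Fin n) → ℝ) : Prop where
  image_eq : ∀ A : EuclideanSpace ℝ (Fin n) ≃ₗᵢ[ℝ] EuclideanSpace ℝ (Fin n), A '' Ω = Ω
  isometric : ∀ A : EuclideanSpace ℝ (Fin n) ≃ₗᵢ[ℝ] EuclideanSpace ℝ (Fin n),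
    ∀ x ∈ Ω, ∀ y, F (A x) (A y) = F x y

/-- `c` is a geodesic of `(Ω, F)` on the open interval `(a, b)`: a regular `C²` curve in `Ω`
which satisfies the Euler-Lagrange equations `d/dt (∂L/∂y) = ∂L/∂x` of the energy
`L = F² / 2` along `(c, c')`, tested against every constant vector `w`. -/
structure IsFinslerGeodesic {n : ℕ} (Ω : Set (EuclideanSpace ℝ (Fin n)))
    (F : EuclideanSpace ℝ (Fin n) → EuclideanSpace ℝ (Fin n) → ℝ)
    (c : ℝ → EuclideanSpace ℝ (Fin n)) (a b : ℝ) : Prop where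
  mem : ∀ t ∈ Set.Ioo a b, c t ∈ Ω
  contDiffOn : ContDiffOn ℝ 2 c (Set.Ioo a b)
  regular : ∀ t ∈ Set.Ioo a b, deriv c t ≠ 0
  eulerLagrange : ∀ t ∈ Set.Ioo a b, ∀ w : EuclideanSpace ℝ (Fin n),
    HasDerivAt (fun τ => fderiv ℝ (fun y => finslerEnergy F (c τ) y) (deriv c τ) w)
      (fderiv ℝ (fun x => finslerEnergy F x (deriv c t)) (c t) w) t

/-- `(Ω, F)` is projective: its geodesics are straight lines, i.e. every geodesic runs inside
a straight line. -/
def IsProjectiveMetric {n : ℕ} (Ω : Set (EuclideanSpace ℝ (Fin n)))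
    (F : EuclideanSpace ℝ (Fin n) → EuclideanSpace ℝ (Fin n) → ℝ) : Prop :=
  ∀ (c : ℝ → EuclideanSpace ℝ (Fin n)) (a b : ℝ), IsFinslerGeodesic Ω F c a b →
    Collinear ℝ (c '' Set.Ioo a b)

/-- `f` is smooth and positive on `{-|x|² : x ∈ Ω}`, and `g` is smooth on `{|x| : x ∈ Ω}`.
If `Ω` is the open ball of radius `R` about `0` (in dimension at least one), these sets are
`(-R², 0]` and `[0, R)`, the ranges of `v²/u² - r²` and of `r` for `r < R`, `|v| ≤ r u`. -/
structure IsAdmissiblePair {n : ℕ} (Ω : Set (EuclideanSpace ℝ (Fin n))) (f g : ℝ → ℝ) :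
    Prop where
  smooth_f : ContDiffOn ℝ ∞ f ((fun x : EuclideanSpace ℝ (Fin n) => -‖x‖ ^ 2) '' Ω)
  pos_f : ∀ x ∈ Ω, 0 < f (-‖x‖ ^ 2)
  smooth_g : ContDiffOn ℝ ∞ g ((fun x : EuclideanSpace ℝ (Fin n) => ‖x‖) '' Ω)

/-- `Φ(r, u, v)` is an indefinite integral `∫ f(v²/u² - r²) du`, on the set of all `(r, u, v)`
with `r ∈ {|x| : x ∈ Ω}`, `u > 0` and `|v| ≤ r u`. For fixed `r` and `v` the variable `u` runs
through an interval, at whose closed end (if there is one) the derivative is one-sided. -/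
def IsAntiderivativeInU {n : ℕ} (Ω : Set (EuclideanSpace ℝ (Fin n))) (f : ℝ → ℝ)
    (Φ : ℝ → ℝ → ℝ → ℝ) : Prop :=
  ∀ x ∈ Ω, ∀ u v : ℝ, 0 < u → |v| ≤ ‖x‖ * u →
    HasDerivWithinAt (fun w => Φ ‖x‖ w v) (f (v ^ 2 / u ^ 2 - ‖x‖ ^ 2))
      {w : ℝ | 0 < w ∧ |v| ≤ ‖x‖ * w} u

/-- The particular antiderivative of `u ↦ f(v²/u² - r²)` whose constant of integration is
normalized at `u = ∞`:
`f(-r²) u - ∫_u^∞ (f(v²/w² - r²) - f(-r²)) dw`. -/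
noncomputable def normalizedAntiderivative (f : ℝ → ℝ) (r u v : ℝ) : ℝ :=
  f (-r ^ 2) * u - ∫ w in Set.Ioi u, (f (v ^ 2 / w ^ 2 - r ^ 2) - f (-r ^ 2))

/-!
The proof rests on Hamel's equations `∂²F/∂xᵏ∂yˡ yᵏ = ∂F/∂xˡ` (`SatisfiesHamel`).

By homogeneity the Euler-Lagrange equations of `F² / 2` at velocity `y` and acceleration `z` reduce
to those of `F`, and by strong convexity the Hessian of `F` in `y` has kernel `ℝ y`. So Hamel's
equations force `z` to be parallel to `y` along every geodesic, and the geodesic is straight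
(`SatisfiesHamel.isProjectiveMetric`). Conversely, geodesics exist for all initial values, and if
they are straight, then Hamel's equations hold at the initial point
(`IsProjectiveMetric.satisfiesHamel`).

What remains is the effect of rotational symmetry, and the bridge is the conservation of angular
momentum: for a skew-symmetric `J`, Hamel's equations and the rotation invariance of `F` make
`F_y(x, y) · J x` constant along straight lines.

* If `F` is given by the formula, then `∂φ/∂u = f(v²/u² - r²)` means
  `F_y(x, y) · z = f(v²/u² - r²) ⟨y, z⟩ / u` for `z ⟂ x` (`HasTransversalProfile`). With `z = J x`,
  everything on the right is constant along lines: `r² - v²/u²` is the squared distance of the line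
  from the origin. So the angular momentum is conserved, which is Hamel's equation in the
  directions orthogonal to `x`; the direction `y` is taken care of by homogeneity
  (`HasTransversalProfile.satisfiesHamel`).
* If Hamel's equations hold, the angular momentum of a line can be computed at the foot of the
  perpendicular from the origin, where Euler's identity gives its value
  (`SatisfiesHamel.phaseDeriv_orthogonal`). This yields `∂φ/∂u = f(v²/u² - r²)` with
  `f(-ρ²) = F(ρ e₂, e₁)`, for orthonormal `e₁`, `e₂`. The difference between `F` and the normalized
  antiderivative does not depend on `u`, and as `u → ∞` it is seen to be `v g(r)` with
  `r g(r) = F_y(r e₂, e₁) · e₂` (`SatisfiesHamel.apply_orthonormal`). One-sided smoothness of `f` and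
  `g` at `0` is a matter of Hadamard's lemma and of Whitney's theorem on even functions
  (`contDiffOn_comp_sqrt_of_even`).

In dimension at most one every metric is projective, and the free constant of integration in the
first equivalence accommodates all of them (`exists_formula_of_le_one`).
-/

open Set Filter Topology MeasureTheory

/-! ### Smooth even functions of one variable -/

section EvenFunctions

variable {S : Set ℝ}

lemma hasDerivAt_integral_pow_mul_comp_mul (hS : IsOpen S)
    (hstar : ∀ ρ ∈ S, ∀ τ ∈ Icc (0 : ℝ) 1, τ * ρ ∈ S) {q : ℝ → ℝ} (hq : ContDiffOn ℝ ∞ q S)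
    (m : ℕ) {ρ : ℝ} (hρ : ρ ∈ S) :
    HasDerivAt (fun ρ => ∫ τ in (0 : ℝ)..1, τ ^ m * q (τ * ρ))
      (∫ τ in (0 : ℝ)..1, τ ^ (m + 1) * deriv q (τ * ρ)) ρ := by
  have hq' : ContDiffOn ℝ ∞ (deriv q) S := hq.deriv_of_isOpen hS (by simp)
  obtain ⟨δ, hδ, hball⟩ := Metric.nhds_basis_closedBall.mem_iff.1 (hS.mem_nhds hρ)
  have hcont : ∀ x ∈ S, ∀ (k : ℕ) (h : ℝ → ℝ), ContinuousOn h S →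
      ContinuousOn (fun τ : ℝ => τ ^ k * h (τ * x)) (Icc 0 1) := fun x hx k h hh =>
    (continuousOn_id.pow k).mul (hh.comp (by fun_prop) fun τ hτ => hstar x hx τ hτ)
  have hmeas : ∀ x ∈ S, ∀ (k : ℕ) (h : ℝ → ℝ), ContinuousOn h S →
      IntervalIntegrable (fun τ : ℝ => τ ^ k * h (τ * x)) volume 0 1 := fun x hx k h hh =>
    ContinuousOn.intervalIntegrable (by simpa [uIcc_of_le] using hcont x hx k h hh)
  have hK : IsCompact (Icc (0 : ℝ) 1 ×ˢ Metric.closedBall ρ δ) :=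
    isCompact_Icc.prod (isCompact_closedBall ρ δ)
  obtain ⟨C, hC⟩ := hK.exists_bound_of_continuousOn
    (f := fun p : ℝ × ℝ => p.1 ^ (m + 1) * deriv q (p.1 * p.2))
    ((by fun_prop : ContinuousOn (fun p : ℝ × ℝ => p.1 ^ (m + 1)) _).mul
      (hq'.continuousOn.comp (by fun_prop) fun p hp => hstar _ (hball hp.2) _ hp.1))
  refine (intervalIntegral.hasDerivAt_integral_of_dominated_loc_of_deriv_le
    (F := fun ρ τ => τ ^ m * q (τ * ρ)) (F' := fun ρ τ => τ ^ (m + 1) * deriv q (τ * ρ))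
    (s := Metric.closedBall ρ δ) (bound := fun _ => C) (Metric.closedBall_mem_nhds ρ hδ)
    ?_ (hmeas ρ hρ m q hq.continuousOn) ?_ ?_ intervalIntegrable_const ?_).2
  · filter_upwards [hS.mem_nhds hρ] with x hx
    exact (hmeas x hx m q hq.continuousOn).def'.aestronglyMeasurable
  · exact (hmeas ρ hρ (m + 1) _ hq'.continuousOn).def'.aestronglyMeasurable
  · refine .of_forall fun τ hτ x hx => hC (τ, x) ⟨?_, hx⟩
    rw [uIoc_of_le zero_le_one] at hτ
    exact Ioc_subset_Icc_self hτ
  · refine .of_forall fun τ hτ x hx => ?_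
    rw [uIoc_of_le zero_le_one] at hτ
    have hd : HasDerivAt q (deriv q (τ * x)) (τ * x) :=
      ((hq.contDiffAt (hS.mem_nhds (hstar x (hball hx) τ
        (Ioc_subset_Icc_self hτ)))).differentiableAt (by simp)).hasDerivAt
    have h1 : HasDerivAt (fun y : ℝ => τ * y) τ x := by
      simpa using (hasDerivAt_id x).const_mul τ
    have := (hd.comp x h1).const_mul (τ ^ m)
    refine this.congr_deriv ?_
    ring

lemma contDiffOn_integral_pow_mul_comp_mul (hS : IsOpen S)
    (hstar : ∀ ρ ∈ S, ∀ τ ∈ Icc (0 : ℝ) 1, τ * ρ ∈ S) (N : ℕ) :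
    ∀ (m : ℕ) {q : ℝ → ℝ}, ContDiffOn ℝ ∞ q S →
      ContDiffOn ℝ N (fun ρ => ∫ τ in (0 : ℝ)..1, τ ^ m * q (τ * ρ)) S := by
  induction N with
  | zero =>
    intro m q hq
    exact contDiffOn_zero.2 fun ρ hρ =>
      (hasDerivAt_integral_pow_mul_comp_mul hS hstar hq m hρ).continuousAt.continuousWithinAt
  | succ N ih =>
    intro m q hq
    push_cast
    rw [contDiffOn_succ_iff_deriv_of_isOpen hS]
    refine ⟨fun ρ hρ => (hasDerivAt_integral_pow_mul_comp_mul hS hstar hq m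
      hρ).differentiableAt.differentiableWithinAt, by simp, ?_⟩
    exact (ih (m + 1) (hq.deriv_of_isOpen hS (by simp))).congr fun ρ hρ =>
      (hasDerivAt_integral_pow_mul_comp_mul hS hstar hq m hρ).deriv

/-- Hadamard's lemma: a smooth function vanishing at `0` is smoothly divisible by the variable. -/
lemma exists_contDiffOn_eq_mul (hS : IsOpen S)
    (hstar : ∀ ρ ∈ S, ∀ τ ∈ Icc (0 : ℝ) 1, τ * ρ ∈ S) {q : ℝ → ℝ} (hq : ContDiffOn ℝ ∞ q S)
    (hq0 : q 0 = 0) :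
    ∃ k : ℝ → ℝ, ContDiffOn ℝ ∞ k S ∧ ∀ ρ ∈ S, q ρ = ρ * k ρ := by
  have hq' : ContDiffOn ℝ ∞ (deriv q) S := hq.deriv_of_isOpen hS (by simp)
  refine ⟨fun ρ => ∫ τ in (0 : ℝ)..1, τ ^ 0 * deriv q (τ * ρ), contDiffOn_infty.2 fun N =>
    contDiffOn_integral_pow_mul_comp_mul hS hstar N 0 hq', fun ρ hρ => ?_⟩
  have hFTC : ∫ τ in (0 : ℝ)..1, ρ * deriv q (τ * ρ) = q (1 * ρ) - q (0 * ρ) := by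
    refine intervalIntegral.integral_eq_sub_of_hasDerivAt (f := fun τ => q (τ * ρ)) ?_ ?_
    · intro τ hτ
      rw [uIcc_of_le zero_le_one] at hτ
      have hd : HasDerivAt q (deriv q (τ * ρ)) (τ * ρ) :=
        ((hq.contDiffAt (hS.mem_nhds (hstar ρ hρ τ hτ))).differentiableAt (by simp)).hasDerivAt
      have h1 : HasDerivAt (fun y : ℝ => y * ρ) ρ τ := by
        simpa using (hasDerivAt_id τ).mul_const ρ
      exact (hd.comp τ h1).congr_deriv (mul_comm _ _)
    · refine ContinuousOn.intervalIntegrable ?_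
      rw [uIcc_of_le zero_le_one]
      exact continuousOn_const.mul (hq'.continuousOn.comp (by fun_prop) fun τ hτ =>
        hstar ρ hρ τ hτ)
  rw [intervalIntegral.integral_const_mul] at hFTC
  simpa [hq0] using hFTC.symm

/-- An even smooth function of `ρ` is a smooth function of `ρ²` (Whitney), one-sidedly smooth at
`0`. In the induction, the derivative of `s ↦ h (√s)` is `k (√s) / 2`, where `h' = ρ k` and `k`
is again even and smooth. -/
lemma contDiffOn_comp_sqrt_of_even (hS : IsOpen S) (h0 : (0 : ℝ) ∈ S)
    (hstar : ∀ ρ ∈ S, ∀ τ ∈ Icc (0 : ℝ) 1, τ * ρ ∈ S) (hneg : ∀ ρ ∈ S, -ρ ∈ S)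
    {h : ℝ → ℝ} (hh : ContDiffOn ℝ ∞ h S) (heven : ∀ ρ ∈ S, h (-ρ) = h ρ) :
    ContDiffOn ℝ ∞ (fun s => h √s) {s | 0 ≤ s ∧ √s ∈ S} := by
  refine contDiffOn_infty.2 fun N => ?_
  induction N generalizing h with
  | zero =>
    exact contDiffOn_zero.2
      (hh.continuousOn.comp Real.continuous_sqrt.continuousOn fun s hs => hs.2)
  | succ N ih =>
    have hh' : ContDiffOn ℝ ∞ (deriv h) S := hh.deriv_of_isOpen hS (by simp)
    have hd : ∀ ρ ∈ S, HasDerivAt h (deriv h ρ) ρ := fun ρ hρ =>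
      ((hh.contDiffAt (hS.mem_nhds hρ)).differentiableAt (by simp)).hasDerivAt
    have hodd : ∀ ρ ∈ S, deriv h (-ρ) = -deriv h ρ := by
      intro ρ hρ
      have h1 : HasDerivAt (fun x => h (-x)) (-deriv h (-ρ)) ρ := 
        ((hd _ (hneg ρ hρ)).comp ρ (hasDerivAt_neg ρ)).congr_deriv (by ring)
      have h2 : HasDerivAt (fun x => h (-x)) (deriv h ρ) ρ :=
        (hd ρ hρ).congr_of_eventuallyEq
          (by filter_upwards [hS.mem_nhds hρ] with x hx using heven x hx)
      linarith [h1.unique h2]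
    obtain ⟨k, hk, hkeq⟩ := exists_contDiffOn_eq_mul hS hstar hh'
      (by have := hodd 0 h0; rw [neg_zero] at this; linarith)
    have hkeven : ∀ ρ ∈ S, k (-ρ) = k ρ := by
      intro ρ hρ
      rcases eq_or_ne ρ 0 with rfl | hne
      · simp
      · have := hodd ρ hρ
        rw [hkeq _ (hneg ρ hρ), hkeq ρ hρ] at this
        exact mul_left_cancel₀ hne (by linarith)
    set T : Set ℝ := {s | 0 ≤ s ∧ √s ∈ S} with hT
    have hderpos : ∀ s ∈ T, 0 < s → HasDerivAt (fun s => h √s) (k √s / 2) s := by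
      intro s hs hpos
      refine ((hd _ hs.2).comp s (Real.hasDerivAt_sqrt hpos.ne')).congr_deriv ?_
      rw [hkeq _ hs.2]
      have := Real.sqrt_pos.2 hpos
      field_simp
    have hder : ∀ s ∈ T, HasDerivWithinAt (fun s => h √s) (k √s / 2) T s := by
      intro s hs
      rcases hs.1.eq_or_lt with rfl | hpos
      · have hsq : Tendsto (fun s : ℝ => √s) (𝓝 0) (𝓝 0) := by
          simpa using Real.continuous_sqrt.tendsto 0
        have hmem : ∀ᶠ s : ℝ in 𝓝 0, √s ∈ S := hsq (hS.mem_nhds h0)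
        refine (hasDerivWithinAt_Ici_of_tendsto_deriv (s := T ∩ Ioi 0) (f := fun s => h √s)
          ?_ ?_ ?_ ?_).mono fun s hs => hs.1
        · exact fun s hs => (hderpos s hs.1 hs.2).differentiableAt.differentiableWithinAt
        · refine ContinuousAt.continuousWithinAt ?_
          exact (hh.contDiffAt (hS.mem_nhds hs.2)).continuousAt.comp
            Real.continuous_sqrt.continuousAt
        · filter_upwards [mem_nhdsWithin_of_mem_nhds hmem, self_mem_nhdsWithin] with s h1 h2
          exact ⟨⟨le_of_lt h2, h1⟩, h2⟩
        · have hlim : Tendsto (fun s : ℝ => k √s / 2) (𝓝[>] 0) (𝓝 (k √0 / 2)) :=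
            ((((hk.contDiffAt (hS.mem_nhds hs.2)).continuousAt.comp
              Real.continuous_sqrt.continuousAt).tendsto).div_const 2).mono_left nhdsWithin_le_nhds
          refine hlim.congr' ?_
          filter_upwards [mem_nhdsWithin_of_mem_nhds hmem, self_mem_nhdsWithin] with s h1 h2
          exact (hderpos s ⟨le_of_lt h2, h1⟩ h2).deriv.symm
      · exact (hderpos s hs hpos).hasDerivWithinAt
    push_cast
    rw [contDiffOn_succ_iff_hasFDerivWithinAt (by simp)]
    intro s hs
    refine ⟨T, ?_, by simp, fun s => ContinuousLinearMap.toSpanSingleton ℝ (k √s / 2),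
      fun s hs => (hder s hs).hasFDerivWithinAt, ?_⟩
    · rw [insert_eq_of_mem hs]
      exact self_mem_nhdsWithin
    · have h1 : ContDiffOn ℝ N (fun s => k √s / 2) T := (ih hk hkeven).div_const 2
      exact (ContinuousLinearMap.toSpanSingletonCLE (𝕜 := ℝ) (E := ℝ)).contDiff.comp_contDiffOn h1

end EvenFunctions

/-! ### Consequences of spherical symmetry -/

section Symmetry

variable {n : ℕ} {Ω : Set (EuclideanSpace ℝ (Fin n))}
  {F : EuclideanSpace ℝ (Fin n) → EuclideanSpace ℝ (Fin n) → ℝ}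

lemma IsSphericallySymmetric.map_mem (hS : IsSphericallySymmetric Ω F)
    (A : EuclideanSpace ℝ (Fin n) ≃ₗᵢ[ℝ] EuclideanSpace ℝ (Fin n))
    {x : EuclideanSpace ℝ (Fin n)} (hx : x ∈ Ω) : A x ∈ Ω := by
  rw [← hS.image_eq A]
  exact mem_image_of_mem A hx

/-- Two pairs of vectors with the same norms and the same inner product are related by an
orthogonal transformation, a product of two reflections. -/
lemma exists_linearIsometryEquiv_map_pair {x y x' y' : EuclideanSpace ℝ (Fin n)}
    (hx : ‖x‖ = ‖x'‖) (hy : ‖y‖ = ‖y'‖) (hxy : inner ℝ x y = inner ℝ x' y') :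
    ∃ A : EuclideanSpace ℝ (Fin n) ≃ₗᵢ[ℝ] EuclideanSpace ℝ (Fin n), A x = x' ∧ A y = y' := by
  obtain ⟨B, hB⟩ : ∃ B : EuclideanSpace ℝ (Fin n) ≃ₗᵢ[ℝ] EuclideanSpace ℝ (Fin n), B x = x' :=
    ⟨_, Submodule.reflection_sub hx⟩
  refine ⟨B.trans (Submodule.reflection (Submodule.span ℝ {B y - y'})ᗮ), ?_, ?_⟩
  · rw [LinearIsometryEquiv.trans_apply, hB]
    refine Submodule.reflection_mem_subspace_eq_self ?_
    rw [Submodule.mem_orthogonal_singleton_iff_inner_right, inner_sub_left,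
      real_inner_comm, real_inner_comm x' y', ← hxy, ← hB, B.inner_map_map, sub_self]
  · rw [LinearIsometryEquiv.trans_apply]
    exact Submodule.reflection_sub (by rw [B.norm_map, hy])

lemma IsSphericallySymmetric.apply_eq (hS : IsSphericallySymmetric Ω F)
    {x y x' y' : EuclideanSpace ℝ (Fin n)} (hxΩ : x ∈ Ω)
    (hx : ‖x‖ = ‖x'‖) (hy : ‖y‖ = ‖y'‖) (hxy : inner ℝ x y = inner ℝ x' y') :
    F x y = F x' y' := by
  obtain ⟨A, rfl, rfl⟩ := exists_linearIsometryEquiv_map_pair hx hy hxy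
  exact (hS.isometric A x hxΩ y).symm

lemma IsSphericallySymmetric.mem_of_norm_eq (hS : IsSphericallySymmetric Ω F)
    {x x' : EuclideanSpace ℝ (Fin n)} (hxΩ : x ∈ Ω) (hx : ‖x‖ = ‖x'‖) : x' ∈ Ω := by
  obtain ⟨A, rfl, -⟩ := exists_linearIsometryEquiv_map_pair hx hx
    (by rw [real_inner_self_eq_norm_sq, real_inner_self_eq_norm_sq, hx])
  exact hS.map_mem A hxΩ

lemma IsSphericallySymmetric.mem_of_norm_le (hS : IsSphericallySymmetric Ω F)
    (hΩ : Convex ℝ Ω) {x x' : EuclideanSpace ℝ (Fin n)} (hxΩ : x ∈ Ω) (hx : ‖x'‖ ≤ ‖x‖) :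
    x' ∈ Ω := by
  rcases eq_or_ne x' 0 with rfl | hne
  · have := hΩ.add_smul_sub_mem hxΩ (hS.mem_of_norm_eq hxΩ (norm_neg x).symm)
      (t := 1 / 2) ⟨by norm_num, by norm_num⟩
    convert this using 1
    module
  · -- `x'` lies on the segment between the two vectors `± z` of norm `‖x‖` on its own line
    have hn : 0 < ‖x'‖ := norm_pos_iff.2 hne
    set z : EuclideanSpace ℝ (Fin n) := (‖x‖ / ‖x'‖) • x' with hz
    have hnz : ‖x‖ = ‖z‖ := by
      rw [hz, norm_smul, norm_div, norm_norm, norm_norm, div_mul_cancel₀ _ hn.ne']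
    have h1 : z ∈ Ω := hS.mem_of_norm_eq hxΩ hnz
    have h2 : -z ∈ Ω := hS.mem_of_norm_eq hxΩ (by rw [norm_neg, hnz])
    have hx0 : 0 < ‖x‖ := hn.trans_le hx
    have hle : ‖x'‖ / ‖x‖ ≤ 1 := (div_le_one hx0).2 hx
    have hge : 0 ≤ ‖x'‖ / ‖x‖ := by positivity
    have := hΩ.add_smul_sub_mem h2 h1 (t := (1 + ‖x'‖ / ‖x‖) / 2)
      ⟨by linarith, by linarith⟩
    convert this using 1
    have : x' = (‖x'‖ / ‖x‖) • z := by
      rw [hz, smul_smul, div_mul_div_cancel₀ hx0.ne', div_self hn.ne', one_smul]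
    nth_rw 1 [this]
    module

/-- The skew-symmetric operator `z ↦ ⟨p, z⟩ q - ⟨q, z⟩ p`, which generates the rotations in the
plane of `p` and `q`. -/
noncomputable def rotationGenerator (p q : EuclideanSpace ℝ (Fin n)) :
    EuclideanSpace ℝ (Fin n) →L[ℝ] EuclideanSpace ℝ (Fin n) :=
  (innerSL ℝ p).smulRight q - (innerSL ℝ q).smulRight p

lemma rotationGenerator_apply (p q z : EuclideanSpace ℝ (Fin n)) :
    rotationGenerator p q z = (inner ℝ p z : ℝ) • q - (inner ℝ q z : ℝ) • p := by
  simp [rotationGenerator]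

lemma inner_rotationGenerator_self (p q z : EuclideanSpace ℝ (Fin n)) :
    (inner ℝ z (rotationGenerator p q z) : ℝ) = 0 := by
  rw [rotationGenerator_apply, inner_sub_right, inner_smul_right, inner_smul_right,
    real_inner_comm p z, real_inner_comm q z]
  ring

/-- The reflections in the lines spanned by `p + s q` depend differentiably on `s`; their
derivative at `s = 0` is a multiple of the generator of rotations composed with the reflection
at `s = 0`. -/
lemma hasDerivAt_reflection_span {p q : EuclideanSpace ℝ (Fin n)} (hp : p ≠ 0)
    (hpq : inner ℝ p q = (0 : ℝ)) (z : EuclideanSpace ℝ (Fin n)) :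
    HasDerivAt (fun s : ℝ => Submodule.reflection (Submodule.span ℝ {p + s • q})
        (Submodule.reflection (Submodule.span ℝ {p}) z))
      ((2 / ‖p‖ ^ 2) • rotationGenerator p q z) 0 := by
  have hp' : ‖p‖ ≠ 0 := norm_ne_zero_iff.2 hp
  set z' := Submodule.reflection (Submodule.span ℝ {p}) z with hz'
  have hpz : (inner ℝ p z' : ℝ) = inner ℝ p z := by
    rw [hz', Submodule.reflection_singleton_apply, inner_sub_right, inner_smul_right_eq_smul,
      inner_smul_right, real_inner_self_eq_norm_sq]
    simp only [RCLike.ofReal_real_eq_id, id_eq, nsmul_eq_mul, Nat.cast_ofNat]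
    field_simp
    ring
  have hqz : (inner ℝ q z' : ℝ) = -inner ℝ q z := by
    rw [hz', Submodule.reflection_singleton_apply, inner_sub_right, inner_smul_right_eq_smul,
      inner_smul_right, real_inner_comm p q, hpq]
    simp
  have hnorm : ∀ s : ℝ, ‖p + s • q‖ ^ 2 = ‖p‖ ^ 2 + s ^ 2 * ‖q‖ ^ 2 := by
    intro s
    rw [norm_add_sq_real, inner_smul_right, hpq, norm_smul, mul_pow, Real.norm_eq_abs, sq_abs]
    ring
  have hfun : (fun s : ℝ => Submodule.reflection (Submodule.span ℝ {p + s • q}) z') =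
      fun s : ℝ => (2 * (((inner ℝ p z : ℝ) - s * inner ℝ q z) /
        (‖p‖ ^ 2 + s ^ 2 * ‖q‖ ^ 2))) • (p + s • q) - z' := by
    funext s
    rw [Submodule.reflection_singleton_apply, inner_add_left, real_inner_smul_left, hpz, hqz]
    simp only [RCLike.ofReal_real_eq_id, id_eq, hnorm]
    rw [mul_neg, ← sub_eq_add_neg, ← Nat.cast_smul_eq_nsmul ℝ, smul_smul]
    norm_num
  rw [hfun]
  have h1 : HasDerivAt (fun s : ℝ => p + s • q) q 0 := by
    simpa using ((hasDerivAt_id (0 : ℝ)).smul_const q).const_add p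
  have h2 : HasDerivAt (fun s : ℝ => (inner ℝ p z : ℝ) - s * inner ℝ q z)
      (-inner ℝ q z) 0 := by
    simpa using ((hasDerivAt_id (0 : ℝ)).mul_const (inner ℝ q z : ℝ)).const_sub (inner ℝ p z)
  have h3 : HasDerivAt (fun s : ℝ => ‖p‖ ^ 2 + s ^ 2 * ‖q‖ ^ 2) 0 0 := by
    simpa using (((hasDerivAt_id (0 : ℝ)).pow 2).mul_const (‖q‖ ^ 2)).const_add (‖p‖ ^ 2)
  have h4 := (((h2.div h3 (by simpa using hp')).const_mul 2).smul h1).sub_const z'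
  refine h4.congr_deriv ?_
  simp only [rotationGenerator_apply]
  simp only [Pi.div_apply, smul_sub, smul_smul, zero_mul, sub_zero, mul_zero, zero_smul, add_zero,
    ne_eq, OfNat.ofNat_ne_zero, not_false_eq_true, zero_pow]
  rw [sub_eq_add_neg, ← neg_smul]
  congr 2 <;> field_simp

end Symmetry

/-! ### First and second derivatives on the tangent bundle -/

section PhaseSpace

variable {n : ℕ} {Ω : Set (EuclideanSpace ℝ (Fin n))}
  {F G : EuclideanSpace ℝ (Fin n) → EuclideanSpace ℝ (Fin n) → ℝ}
  {x y : EuclideanSpace ℝ (Fin n)}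

/-- The joint derivative of `G (x, y)` in the point `x` and the tangent vector `y`; its values at
`(w, 0)` and `(0, w)` are the partial derivatives in the direction `w`. -/
noncomputable def phaseDeriv (G : EuclideanSpace ℝ (Fin n) → EuclideanSpace ℝ (Fin n) → ℝ)
    (p : EuclideanSpace ℝ (Fin n) × EuclideanSpace ℝ (Fin n)) :
    EuclideanSpace ℝ (Fin n) × EuclideanSpace ℝ (Fin n) →L[ℝ] ℝ :=
  fderiv ℝ (fun p : EuclideanSpace ℝ (Fin n) × EuclideanSpace ℝ (Fin n) => G p.1 p.2) p

/-- The joint second derivative of `G (x, y)`. -/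
noncomputable def phaseDeriv₂ (G : EuclideanSpace ℝ (Fin n) → EuclideanSpace ℝ (Fin n) → ℝ)
    (p : EuclideanSpace ℝ (Fin n) × EuclideanSpace ℝ (Fin n)) :
    EuclideanSpace ℝ (Fin n) × EuclideanSpace ℝ (Fin n) →L[ℝ]
      EuclideanSpace ℝ (Fin n) × EuclideanSpace ℝ (Fin n) →L[ℝ] ℝ :=
  fderiv ℝ (phaseDeriv G) p

/-- `G` is smooth in `(x, y)` for `x ∈ Ω` and `y ≠ 0`. -/
def SmoothOffZeroSection (Ω : Set (EuclideanSpace ℝ (Fin n)))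
    (G : EuclideanSpace ℝ (Fin n) → EuclideanSpace ℝ (Fin n) → ℝ) : Prop :=
  ContDiffOn ℝ ∞ (fun p : EuclideanSpace ℝ (Fin n) × EuclideanSpace ℝ (Fin n) => G p.1 p.2)
    (Ω ×ˢ {0}ᶜ)

lemma mem_nhds_prod_compl_zero (hΩ : IsOpen Ω) (hx : x ∈ Ω) (hy : y ≠ 0) :
    Ω ×ˢ ({0}ᶜ : Set (EuclideanSpace ℝ (Fin n))) ∈ 𝓝 (x, y) :=
  (hΩ.prod isOpen_compl_singleton).mem_nhds ⟨hx, hy⟩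

namespace SmoothOffZeroSection

lemma contDiffOn_phaseDeriv (hG : SmoothOffZeroSection Ω G) (hΩ : IsOpen Ω) :
    ContDiffOn ℝ ∞ (phaseDeriv G) (Ω ×ˢ {0}ᶜ) :=
  hG.fderiv_of_isOpen (hΩ.prod isOpen_compl_singleton) (by simp)

lemma contDiffOn_phaseDeriv₂ (hG : SmoothOffZeroSection Ω G) (hΩ : IsOpen Ω) :
    ContDiffOn ℝ ∞ (phaseDeriv₂ G) (Ω ×ˢ {0}ᶜ) :=
  (hG.contDiffOn_phaseDeriv hΩ).fderiv_of_isOpen (hΩ.prod isOpen_compl_singleton) (by simp)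

lemma hasFDerivAt (hG : SmoothOffZeroSection Ω G) (hΩ : IsOpen Ω) (hx : x ∈ Ω) (hy : y ≠ 0) :
    HasFDerivAt (fun p : EuclideanSpace ℝ (Fin n) × EuclideanSpace ℝ (Fin n) => G p.1 p.2)
      (phaseDeriv G (x, y)) (x, y) :=
  ((hG.contDiffAt (mem_nhds_prod_compl_zero hΩ hx hy)).differentiableAt (by simp)).hasFDerivAt

lemma hasFDerivAt_phaseDeriv (hG : SmoothOffZeroSection Ω G) (hΩ : IsOpen Ω) (hx : x ∈ Ω)
    (hy : y ≠ 0) : HasFDerivAt (phaseDeriv G) (phaseDeriv₂ G (x, y)) (x, y) :=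
  (((hG.contDiffOn_phaseDeriv hΩ).contDiffAt
    (mem_nhds_prod_compl_zero hΩ hx hy)).differentiableAt (by simp)).hasFDerivAt

lemma phaseDeriv₂_symm (hG : SmoothOffZeroSection Ω G) (hΩ : IsOpen Ω) (hx : x ∈ Ω)
    (hy : y ≠ 0) (a b : EuclideanSpace ℝ (Fin n) × EuclideanSpace ℝ (Fin n)) :
    phaseDeriv₂ G (x, y) a b = phaseDeriv₂ G (x, y) b a :=
  (contDiffAt_infty.1 (hG.contDiffAt (mem_nhds_prod_compl_zero hΩ hx hy)) 2).isSymmSndFDerivAt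
    (by simp) a b

lemma fderiv_snd (hG : SmoothOffZeroSection Ω G) (hΩ : IsOpen Ω) (hx : x ∈ Ω) (hy : y ≠ 0) :
    fderiv ℝ (fun y => G x y) y =
      (phaseDeriv G (x, y)).comp (ContinuousLinearMap.inr ℝ _ _) :=
  ((hG.hasFDerivAt hΩ hx hy).comp y (hasFDerivAt_prodMk_right x y)).fderiv

lemma fderiv_fst (hG : SmoothOffZeroSection Ω G) (hΩ : IsOpen Ω) (hx : x ∈ Ω) (hy : y ≠ 0) :
    fderiv ℝ (fun x => G x y) x =
      (phaseDeriv G (x, y)).comp (ContinuousLinearMap.inl ℝ _ _) :=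
  HasFDerivAt.fderiv (HasFDerivAt.comp (f := fun x => (x, y)) x (hG.hasFDerivAt hΩ hx hy)
    (hasFDerivAt_prodMk_left x y))

lemma hasDerivAt_comp (hG : SmoothOffZeroSection Ω G) (hΩ : IsOpen Ω)
    {c v : ℝ → EuclideanSpace ℝ (Fin n)} {c' v' : EuclideanSpace ℝ (Fin n)} {t : ℝ}
    (hc : HasDerivAt c c' t) (hv : HasDerivAt v v' t) (hx : c t ∈ Ω) (hy : v t ≠ 0) :
    HasDerivAt (fun s => G (c s) (v s)) (phaseDeriv G (c t, v t) (c', v')) t :=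
  HasFDerivAt.comp_hasDerivAt (f := fun s => (c s, v s)) t (hG.hasFDerivAt hΩ hx hy)
    (hc.prodMk hv)

lemma hasDerivAt_phaseDeriv_comp (hG : SmoothOffZeroSection Ω G) (hΩ : IsOpen Ω)
    {c v : ℝ → EuclideanSpace ℝ (Fin n)} {c' v' : EuclideanSpace ℝ (Fin n)} {t : ℝ}
    (hc : HasDerivAt c c' t) (hv : HasDerivAt v v' t) (hx : c t ∈ Ω) (hy : v t ≠ 0) :
    HasDerivAt (fun s => phaseDeriv G (c s, v s)) (phaseDeriv₂ G (c t, v t) (c', v')) t :=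
  (hG.hasFDerivAt_phaseDeriv hΩ hx hy).comp_hasDerivAt t (hc.prodMk hv)

end SmoothOffZeroSection

namespace IsFinslerMetricOn

lemma smoothOffZeroSection (hF : IsFinslerMetricOn Ω F) : SmoothOffZeroSection Ω F :=
  hF.smooth

lemma smoothOffZeroSection_energy (hF : IsFinslerMetricOn Ω F) :
    SmoothOffZeroSection Ω (finslerEnergy F) :=
  (hF.smooth.pow 2).div_const 2

/-- Euler's identity for functions that are positively homogeneous of degree one in `y`. -/
lemma phaseDeriv_euler (hF : IsFinslerMetricOn Ω F) (hΩ : IsOpen Ω) (hx : x ∈ Ω) (hy : y ≠ 0) :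
    phaseDeriv F (x, y) (0, y) = F x y := by
  have h1 : HasDerivAt (fun s : ℝ => F x (s • y)) (phaseDeriv F (x, (1 : ℝ) • y) (0, y)) 1 := by
    refine hF.smoothOffZeroSection.hasDerivAt_comp hΩ (c := fun _ => x) (v := fun s : ℝ => s • y)
      (hasDerivAt_const _ _) ?_ hx (by simpa using hy)
    simpa using (hasDerivAt_id (1 : ℝ)).smul_const y
  have h2 : HasDerivAt (fun s : ℝ => F x (s • y)) (F x y) 1 := by
    refine HasDerivAt.congr_of_eventuallyEq (f := fun s : ℝ => s * F x y) ?_ ?_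
    · simpa using (hasDerivAt_id (1 : ℝ)).mul_const (F x y)
    · filter_upwards [lt_mem_nhds (zero_lt_one' ℝ)] with s hs using hF.homogeneous x hx y s hs
  rw [one_smul] at h1
  exact h1.unique h2

/-- The derivative of Euler's identity. -/
lemma phaseDeriv₂_euler (hF : IsFinslerMetricOn Ω F) (hΩ : IsOpen Ω) (hx : x ∈ Ω) (hy : y ≠ 0)
    (a b : EuclideanSpace ℝ (Fin n)) :
    phaseDeriv₂ F (x, y) (a, b) (0, y) = phaseDeriv F (x, y) (a, 0) := by
  have hS := hF.smoothOffZeroSection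
  have hc : HasDerivAt (fun s : ℝ => x + s • a) a 0 := by
    simpa using ((hasDerivAt_id (0 : ℝ)).smul_const a).const_add x
  have hv : HasDerivAt (fun s : ℝ => y + s • b) b 0 := by
    simpa using ((hasDerivAt_id (0 : ℝ)).smul_const b).const_add y
  have h0v : HasDerivAt (fun s : ℝ => ((0 : EuclideanSpace ℝ (Fin n)), y + s • b)) (0, b) 0 :=
    (hasDerivAt_const _ _).prodMk hv
  have h1 := (hS.hasDerivAt_phaseDeriv_comp hΩ hc hv (by simpa using hx)
    (by simpa using hy)).clm_apply h0v
  have h2 := hS.hasDerivAt_comp hΩ hc hv (by simpa using hx) (by simpa using hy)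
  have h3 : (fun s : ℝ => phaseDeriv F (x + s • a, y + s • b) (0, y + s • b)) =ᶠ[𝓝 0]
      fun s => F (x + s • a) (y + s • b) := by
    filter_upwards [hc.continuousAt.eventually_mem (hΩ.mem_nhds (by simpa using hx)),
      hv.continuousAt.eventually_ne (by simpa using hy)] with s hs1 hs2
    exact hF.phaseDeriv_euler hΩ hs1 hs2
  have h4 := (h1.congr_of_eventuallyEq h3.symm).unique h2
  simp only [zero_smul, add_zero] at h4
  have h5 : ((a, b) : EuclideanSpace ℝ (Fin n) × EuclideanSpace ℝ (Fin n)) = (a, 0) + (0, b) := by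
    simp
  nth_rw 2 [h5] at h4
  rw [map_add] at h4
  exact add_right_cancel h4

lemma phaseDeriv_energy (hF : IsFinslerMetricOn Ω F) (hΩ : IsOpen Ω) (hx : x ∈ Ω) (hy : y ≠ 0) :
    phaseDeriv (finslerEnergy F) (x, y) = F x y • phaseDeriv F (x, y) := by
  have h := (((hF.smoothOffZeroSection.hasFDerivAt hΩ hx hy).pow 2).mul_const (2⁻¹ : ℝ)).fderiv
  unfold phaseDeriv finslerEnergy
  simp only [div_eq_mul_inv]
  rw [h]
  ext a <;> simp [phaseDeriv] <;> ring

lemma phaseDeriv₂_energy (hF : IsFinslerMetricOn Ω F) (hΩ : IsOpen Ω) (hx : x ∈ Ω)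
    (hy : y ≠ 0) (a b : EuclideanSpace ℝ (Fin n) × EuclideanSpace ℝ (Fin n)) :
    phaseDeriv₂ (finslerEnergy F) (x, y) a b =
      phaseDeriv F (x, y) a * phaseDeriv F (x, y) b + F x y * phaseDeriv₂ F (x, y) a b := by
  have hS := hF.smoothOffZeroSection
  have h1 := (hS.hasFDerivAt hΩ hx hy).smul (hS.hasFDerivAt_phaseDeriv hΩ hx hy)
  have h2 : phaseDeriv (finslerEnergy F) =ᶠ[𝓝 (x, y)]
      (fun p : EuclideanSpace ℝ (Fin n) × EuclideanSpace ℝ (Fin n) => F p.1 p.2) •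
        phaseDeriv F := by
    filter_upwards [mem_nhds_prod_compl_zero hΩ hx hy] with p hp
    exact hF.phaseDeriv_energy hΩ hp.1 hp.2
  rw [phaseDeriv₂, h2.fderiv_eq, h1.fderiv]
  simp only [add_apply, smul_apply,
    ContinuousLinearMap.smulRight_apply, smul_eq_mul]
  ring

lemma phaseDeriv₂_energy_pos (hF : IsFinslerMetricOn Ω F) (hΩ : IsOpen Ω) (hx : x ∈ Ω)
    (hy : y ≠ 0) {w : EuclideanSpace ℝ (Fin n)} (hw : w ≠ 0) :
    0 < phaseDeriv₂ (finslerEnergy F) (x, y) (0, w) (0, w) := by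
  have hS := hF.smoothOffZeroSection_energy
  have h1 : fderiv ℝ (finslerEnergy F x) =ᶠ[𝓝 y] fun y =>
      (phaseDeriv (finslerEnergy F) (x, y)).comp (ContinuousLinearMap.inr ℝ _ _) := by
    filter_upwards [isOpen_compl_singleton.mem_nhds hy] with y hy
    exact hS.fderiv_snd hΩ hx hy
  have h2 := ((hS.hasFDerivAt_phaseDeriv hΩ hx hy).comp y
    (hasFDerivAt_prodMk_right x y)).clm_comp
      (hasFDerivAt_const (ContinuousLinearMap.inr ℝ (EuclideanSpace ℝ (Fin n))
        (EuclideanSpace ℝ (Fin n))) y)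
  have h3 := hF.posDef x hx y hy w hw
  rw [h1.fderiv_eq] at h3
  have h4 := h2.fderiv
  simp only [Function.comp_def] at h4
  rw [h4] at h3
  simpa using h3

end IsFinslerMetricOn

/-! ### Infinitesimal rotations and straight geodesics -/

/-- The infinitesimal form of spherical symmetry: `F` is invariant under simultaneous infinitesimal
rotations of `x` and `y`. -/
lemma IsSphericallySymmetric.phaseDeriv_rotationGenerator (hsym : IsSphericallySymmetric Ω F)
    (hS : SmoothOffZeroSection Ω F) (hΩ : IsOpen Ω) {p q : EuclideanSpace ℝ (Fin n)} (hp : p ≠ 0)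
    (hpq : inner ℝ p q = (0 : ℝ)) (hx : x ∈ Ω) (hy : y ≠ 0) :
    phaseDeriv F (x, y) (rotationGenerator p q x, rotationGenerator p q y) = 0 := by
  have hrefl : ∀ z : EuclideanSpace ℝ (Fin n),
      Submodule.reflection (Submodule.span ℝ {p + (0 : ℝ) • q})
        (Submodule.reflection (Submodule.span ℝ {p}) z) = z := by
    intro z
    rw [zero_smul, add_zero, Submodule.reflection_reflection]
  have h1 := hS.hasDerivAt_comp hΩ (hasDerivAt_reflection_span hp hpq x)
    (hasDerivAt_reflection_span hp hpq y) (by rwa [hrefl]) (by rwa [hrefl])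
  have h2 : (fun s : ℝ => F
      (Submodule.reflection (Submodule.span ℝ {p + s • q})
        (Submodule.reflection (Submodule.span ℝ {p}) x))
      (Submodule.reflection (Submodule.span ℝ {p + s • q})
        (Submodule.reflection (Submodule.span ℝ {p}) y))) = fun _ => F x y := by
    funext s
    rw [hsym.isometric _ _ (hsym.map_mem _ hx), hsym.isometric _ _ hx]
  rw [h2, hrefl, hrefl] at h1
  have h3 := h1.unique (hasDerivAt_const _ _)
  rw [← Prod.smul_mk, map_smul, smul_eq_mul] at h3
  exact (mul_eq_zero.1 h3).resolve_left
    (div_ne_zero two_ne_zero (pow_ne_zero _ (norm_ne_zero_iff.2 hp)))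

/-- Hamel's equations `∂²F/∂xᵏ∂yˡ yᵏ = ∂F/∂xˡ`, which express that the straight lines are
geodesics of `F`. -/
def SatisfiesHamel (Ω : Set (EuclideanSpace ℝ (Fin n)))
    (F : EuclideanSpace ℝ (Fin n) → EuclideanSpace ℝ (Fin n) → ℝ) : Prop :=
  ∀ x ∈ Ω, ∀ y, y ≠ 0 → ∀ w,
    phaseDeriv₂ F (x, y) (y, 0) (0, w) = phaseDeriv F (x, y) (w, 0)

/-- The derivative of the angular momentum `F_y(x, y) · J x`, with `J` skew-symmetric, along a
straight line. -/
lemma SmoothOffZeroSection.hasDerivAt_angularMomentum (hS : SmoothOffZeroSection Ω F)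
    (hΩ : IsOpen Ω) (J : EuclideanSpace ℝ (Fin n) →L[ℝ] EuclideanSpace ℝ (Fin n)) {t : ℝ}
    (hx : x + t • y ∈ Ω) (hy : y ≠ 0) :
    HasDerivAt (fun t : ℝ => phaseDeriv F (x + t • y, y) (0, J (x + t • y)))
      (phaseDeriv₂ F (x + t • y, y) (y, 0) (0, J (x + t • y)) +
        phaseDeriv F (x + t • y, y) (0, J y)) t := by
  have hc : HasDerivAt (fun t : ℝ => x + t • y) y t := by
    simpa using ((hasDerivAt_id t).smul_const y).const_add x
  exact (hS.hasDerivAt_phaseDeriv_comp hΩ hc (hasDerivAt_const t y) hx hy).clm_apply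
    ((hasDerivAt_const t 0).prodMk (J.hasFDerivAt.comp_hasDerivAt t hc))

/-- Noether's theorem for rotations: if straight lines are geodesics, then the angular momentum is
constant along them. -/
lemma SatisfiesHamel.hasDerivAt_angularMomentum_zero (hH : SatisfiesHamel Ω F)
    (hsym : IsSphericallySymmetric Ω F) (hS : SmoothOffZeroSection Ω F) (hΩ : IsOpen Ω)
    {p q : EuclideanSpace ℝ (Fin n)} (hp : p ≠ 0) (hpq : inner ℝ p q = (0 : ℝ)) {t : ℝ}
    (hx : x + t • y ∈ Ω) (hy : y ≠ 0) :
    HasDerivAt (fun t : ℝ => phaseDeriv F (x + t • y, y) (0, rotationGenerator p q (x + t • y)))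
      0 t := by
  refine (hS.hasDerivAt_angularMomentum hΩ _ hx hy).congr_deriv ?_
  rw [hH _ hx y hy, ← map_add, Prod.mk_add_mk, add_zero, zero_add]
  exact hsym.phaseDeriv_rotationGenerator hS hΩ hp hpq hx hy

end PhaseSpace

/-! ### Geodesics and Hamel's equations -/

section Geodesics

variable {n : ℕ} {Ω : Set (EuclideanSpace ℝ (Fin n))}
  {F : EuclideanSpace ℝ (Fin n) → EuclideanSpace ℝ (Fin n) → ℝ}
  {x y z : EuclideanSpace ℝ (Fin n)}

/-- The Euler-Lagrange equations of the energy `F² / 2`, at a velocity `y` and an acceleration `z`,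
imply those of `F`. Testing them against `y` shows that the derivative of `F` in the direction
`(y, z)` vanishes. -/
lemma IsFinslerMetricOn.eulerLagrange_of_energy (hF : IsFinslerMetricOn Ω F) (hΩ : IsOpen Ω)
    (hx : x ∈ Ω) (hy : y ≠ 0)
    (hEL : ∀ w, phaseDeriv₂ (finslerEnergy F) (x, y) (y, z) (0, w) =
      phaseDeriv (finslerEnergy F) (x, y) (w, 0))
    (w : EuclideanSpace ℝ (Fin n)) :
    phaseDeriv₂ F (x, y) (y, z) (0, w) = phaseDeriv F (x, y) (w, 0) := by
  have hpos : F x y ≠ 0 := (hF.pos x hx y hy).ne'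
  have hEL' : ∀ w, phaseDeriv F (x, y) (y, z) * phaseDeriv F (x, y) (0, w) +
      F x y * phaseDeriv₂ F (x, y) (y, z) (0, w) = F x y * phaseDeriv F (x, y) (w, 0) := by
    intro w
    rw [← hF.phaseDeriv₂_energy hΩ hx hy, hEL, hF.phaseDeriv_energy hΩ hx hy, smul_apply,
      smul_eq_mul]
  have h0 : phaseDeriv F (x, y) (y, z) = 0 := by
    have := hEL' y
    rw [hF.phaseDeriv_euler hΩ hx hy, hF.phaseDeriv₂_euler hΩ hx hy] at this
    exact (mul_eq_zero.1 (by linarith : phaseDeriv F (x, y) (y, z) * F x y = 0)).resolve_right hpos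
  have := hEL' w
  rw [h0, zero_mul, zero_add] at this
  exact mul_left_cancel₀ hpos this

/-- By strong convexity, the kernel of the Hessian of `F` in `y` is spanned by `y`. -/
lemma IsFinslerMetricOn.exists_eq_smul_of_hessian_apply_eq_zero (hF : IsFinslerMetricOn Ω F)
    (hΩ : IsOpen Ω) (hx : x ∈ Ω) (hy : y ≠ 0)
    (hz : ∀ w, phaseDeriv₂ F (x, y) (0, z) (0, w) = 0) : ∃ l : ℝ, z = l • y := by
  have hpos : F x y ≠ 0 := (hF.pos x hx y hy).ne'
  set l : ℝ := phaseDeriv F (x, y) (0, z) / F x y with hl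
  refine ⟨l, ?_⟩
  by_contra hne
  have hw : z - l • y ≠ 0 := sub_ne_zero.2 hne
  have hsplit : ((0, z - l • y) : EuclideanSpace ℝ (Fin n) × EuclideanSpace ℝ (Fin n)) =
      (0, z) - l • (0, y) := by simp
  have h1 : phaseDeriv F (x, y) (0, z - l • y) = 0 := by
    rw [hsplit, map_sub, map_smul, hF.phaseDeriv_euler hΩ hx hy, hl, smul_eq_mul,
      div_mul_cancel₀ _ hpos, sub_self]
  have h2 : phaseDeriv₂ F (x, y) (0, z - l • y) (0, z - l • y) = 0 := by
    have h3 : phaseDeriv₂ F (x, y) (0, y) (0, z - l • y) = 0 := by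
      rw [hF.smoothOffZeroSection.phaseDeriv₂_symm hΩ hx hy, hF.phaseDeriv₂_euler hΩ hx hy,
        Prod.mk_zero_zero, map_zero]
    nth_rw 1 [hsplit]
    rw [map_sub, map_smul, sub_apply, smul_apply, h3, hz, smul_zero, sub_zero]
  have h4 := hF.phaseDeriv₂_energy_pos hΩ hx hy hw
  rw [hF.phaseDeriv₂_energy hΩ hx hy, h1, h2] at h4
  simp at h4

lemma hasDerivAt_and_deriv_of_contDiffOn_two {c : ℝ → EuclideanSpace ℝ (Fin n)} {a b t : ℝ}
    (hc : ContDiffOn ℝ 2 c (Ioo a b)) (ht : t ∈ Ioo a b) :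
    HasDerivAt c (deriv c t) t ∧ HasDerivAt (deriv c) (deriv (deriv c) t) t := by
  have hc' : ContDiffOn ℝ 1 (deriv c) (Ioo a b) :=
    hc.deriv_of_isOpen isOpen_Ioo (by norm_num)
  exact ⟨((hc.contDiffAt (isOpen_Ioo.mem_nhds ht)).differentiableAt (by simp)).hasDerivAt,
    ((hc'.contDiffAt (isOpen_Ioo.mem_nhds ht)).differentiableAt (by simp)).hasDerivAt⟩

lemma IsFinslerGeodesic.phaseDeriv₂_energy_eq {c : ℝ → EuclideanSpace ℝ (Fin n)} {a b t : ℝ}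
    (hc : IsFinslerGeodesic Ω F c a b) (hF : IsFinslerMetricOn Ω F) (hΩ : IsOpen Ω)
    (ht : t ∈ Ioo a b) (w : EuclideanSpace ℝ (Fin n)) :
    phaseDeriv₂ (finslerEnergy F) (c t, deriv c t) (deriv c t, deriv (deriv c) t) (0, w) =
      phaseDeriv (finslerEnergy F) (c t, deriv c t) (w, 0) := by
  have hS := hF.smoothOffZeroSection_energy
  obtain ⟨hd1, hd2⟩ := hasDerivAt_and_deriv_of_contDiffOn_two hc.contDiffOn ht
  have h1 := (hS.hasDerivAt_phaseDeriv_comp hΩ hd1 hd2 (hc.mem t ht) (hc.regular t ht)).clm_apply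
    (hasDerivAt_const t ((0, w) : EuclideanSpace ℝ (Fin n) × EuclideanSpace ℝ (Fin n)))
  have h2 := hc.eulerLagrange t ht w
  rw [hS.fderiv_fst hΩ (hc.mem t ht) (hc.regular t ht)] at h2
  have h3 : (fun τ => phaseDeriv (finslerEnergy F) (c τ, deriv c τ) (0, w)) =ᶠ[𝓝 t]
      fun τ => fderiv ℝ (fun y => finslerEnergy F (c τ) y) (deriv c τ) w := by
    filter_upwards [isOpen_Ioo.mem_nhds ht] with τ hτ
    rw [hS.fderiv_snd hΩ (hc.mem τ hτ) (hc.regular τ hτ)]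
    simp
  simpa using h1.unique (h2.congr_of_eventuallyEq h3)

/-- A curve whose acceleration is a multiple of its velocity has a constant unit tangent vector,
hence runs inside a straight line. -/
lemma collinear_image_of_acceleration_parallel {c v : ℝ → EuclideanSpace ℝ (Fin n)} {a b : ℝ}
    {l : ℝ → ℝ} (hc : ∀ t ∈ Ioo a b, HasDerivAt c (v t) t)
    (hv : ∀ t ∈ Ioo a b, HasDerivAt v (l t • v t) t) (hne : ∀ t ∈ Ioo a b, v t ≠ 0) :
    Collinear ℝ (c '' Ioo a b) := by
  rcases (Ioo a b).eq_empty_or_nonempty with he | ⟨t₀, ht₀⟩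
  · rw [he, image_empty]
    exact collinear_empty ℝ _
  have hnorm : ∀ t ∈ Ioo a b, HasDerivAt (fun t => ‖v t‖) (l t * ‖v t‖) t := by
    intro t ht
    have h1 := (hv t ht).norm_sq.sqrt (pow_ne_zero 2 (norm_ne_zero_iff.2 (hne t ht)))
    simp only [Real.sqrt_sq (norm_nonneg _)] at h1
    refine h1.congr_deriv ?_
    rw [inner_smul_right, real_inner_self_eq_norm_sq]
    have := norm_ne_zero_iff.2 (hne t ht)
    field_simp
  have hunit : ∀ t ∈ Ioo a b, HasDerivAt (fun t => ‖v t‖⁻¹ • v t) 0 t := by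
    intro t ht
    have h0 := norm_ne_zero_iff.2 (hne t ht)
    refine (((hnorm t ht).inv h0).smul (hv t ht)).congr_deriv ?_
    rw [smul_smul, ← add_smul]
    convert zero_smul ℝ (v t) using 2
    simp only [Pi.inv_apply]
    field_simp
    ring
  set e : EuclideanSpace ℝ (Fin n) := ‖v t₀‖⁻¹ • v t₀ with he
  have hconst : ∀ t ∈ Ioo a b, ‖v t‖⁻¹ • v t = e := fun t ht =>
    isOpen_Ioo.is_const_of_deriv_eq_zero isPreconnected_Ioo
      (fun s hs => (hunit s hs).differentiableAt.differentiableWithinAt)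
      (fun s hs => (hunit s hs).deriv) ht ht₀
  have hvt : ∀ t ∈ Ioo a b, v t = ‖v t‖ • e := by
    intro t ht
    rw [← hconst t ht, smul_smul, mul_inv_cancel₀ (norm_ne_zero_iff.2 (hne t ht)), one_smul]
  have hee : (inner ℝ e e : ℝ) = 1 := by
    rw [real_inner_self_eq_norm_sq, he, norm_smul, norm_inv, norm_norm,
      inv_mul_cancel₀ (norm_ne_zero_iff.2 (hne t₀ ht₀)), one_pow]
  have hproj : ∀ t ∈ Ioo a b, HasDerivAt (fun t => c t - (inner ℝ e (c t) : ℝ) • e) 0 t := by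
    intro t ht
    have h1 : HasDerivAt (fun t => (inner ℝ e (c t) : ℝ)) (inner ℝ e (v t)) t := by
      simpa using (hasDerivAt_const t e).inner ℝ (hc t ht)
    refine ((hc t ht).sub (h1.smul_const e)).congr_deriv ?_
    rw [hvt t ht, inner_smul_right, hee, mul_one, sub_self]
  rw [collinear_iff_of_mem (mem_image_of_mem c ht₀)]
  refine ⟨e, ?_⟩
  rintro _ ⟨t, ht, rfl⟩
  refine ⟨inner ℝ e (c t) - inner ℝ e (c t₀), ?_⟩
  have := isOpen_Ioo.is_const_of_deriv_eq_zero isPreconnected_Ioo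
      (fun s hs => (hproj s hs).differentiableAt.differentiableWithinAt)
      (fun s hs => (hproj s hs).deriv) ht ht₀
  rw [sub_eq_sub_iff_add_eq_add] at this
  rw [vadd_eq_add, sub_smul, sub_add_eq_add_sub, add_comm, this.symm.trans (add_comm _ _)]
  abel

lemma SatisfiesHamel.isProjectiveMetric (hH : SatisfiesHamel Ω F) (hF : IsFinslerMetricOn Ω F)
    (hΩ : IsOpen Ω) : IsProjectiveMetric Ω F := by
  intro c a b hc
  have hpar : ∀ t ∈ Ioo a b, ∃ l : ℝ, deriv (deriv c) t = l • deriv c t := by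
    intro t ht
    have hx := hc.mem t ht
    have hy := hc.regular t ht
    refine hF.exists_eq_smul_of_hessian_apply_eq_zero hΩ hx hy fun w => ?_
    have h1 := hF.eulerLagrange_of_energy hΩ hx hy (hc.phaseDeriv₂_energy_eq hF hΩ ht) w
    have h2 : ((deriv c t, deriv (deriv c) t) :
        EuclideanSpace ℝ (Fin n) × EuclideanSpace ℝ (Fin n)) =
        (deriv c t, 0) + (0, deriv (deriv c) t) := by simp
    rw [h2, map_add, add_apply, hH _ hx _ hy] at h1
    linarith
  choose! l hl using hpar
  refine collinear_image_of_acceleration_parallel (v := deriv c) (l := l)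
    (fun t ht => (hasDerivAt_and_deriv_of_contDiffOn_two hc.contDiffOn ht).1) (fun t ht => ?_)
    hc.regular
  rw [← hl t ht]
  exact (hasDerivAt_and_deriv_of_contDiffOn_two hc.contDiffOn ht).2

/-- Geodesics exist for arbitrary initial values: the Euler-Lagrange equations can be solved
smoothly for the acceleration, since the fundamental tensor is invertible, and the
Picard-Lindelöf theorem applies. -/
lemma IsFinslerMetricOn.exists_geodesic (hF : IsFinslerMetricOn Ω F) (hΩ : IsOpen Ω)
    (hx : x ∈ Ω) (hy : y ≠ 0) :
    ∃ (c : ℝ → EuclideanSpace ℝ (Fin n)) (ε : ℝ), 0 < ε ∧ IsFinslerGeodesic Ω F c (-ε) ε ∧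
      c 0 = x ∧ deriv c 0 = y := by
  set U : Set (EuclideanSpace ℝ (Fin n) × EuclideanSpace ℝ (Fin n)) := Ω ×ˢ {0}ᶜ with hU
  have hUo : IsOpen U := hΩ.prod isOpen_compl_singleton
  have hS := hF.smoothOffZeroSection_energy
  have hD1 := hS.contDiffOn_phaseDeriv hΩ
  have hD2 := hS.contDiffOn_phaseDeriv₂ hΩ
  set L := finslerEnergy F with hL
  -- restriction of covectors on the phase space to the vertical and the horizontal vectors
  let vert := (ContinuousLinearMap.compL ℝ (EuclideanSpace ℝ (Fin n))
    (EuclideanSpace ℝ (Fin n) × EuclideanSpace ℝ (Fin n)) ℝ).flip (ContinuousLinearMap.inr ℝ _ _)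
  let horiz := (ContinuousLinearMap.compL ℝ (EuclideanSpace ℝ (Fin n))
    (EuclideanSpace ℝ (Fin n) × EuclideanSpace ℝ (Fin n)) ℝ).flip (ContinuousLinearMap.inl ℝ _ _)
  let g : EuclideanSpace ℝ (Fin n) × EuclideanSpace ℝ (Fin n) →
      EuclideanSpace ℝ (Fin n) →L[ℝ] EuclideanSpace ℝ (Fin n) →L[ℝ] ℝ := fun p =>
    vert.comp ((phaseDeriv₂ L p).comp (ContinuousLinearMap.inr ℝ _ _))
  let R : EuclideanSpace ℝ (Fin n) × EuclideanSpace ℝ (Fin n) →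
      EuclideanSpace ℝ (Fin n) →L[ℝ] ℝ := fun p =>
    horiz (phaseDeriv L p) - vert (phaseDeriv₂ L p (p.2, 0))
  let Z : EuclideanSpace ℝ (Fin n) × EuclideanSpace ℝ (Fin n) → EuclideanSpace ℝ (Fin n) :=
    fun p => (g p).inverse (R p)
  have hinv : ∀ p ∈ U, (g p).IsInvertible := by
    intro p hp
    have hinj : Function.Injective (g p : EuclideanSpace ℝ (Fin n) →ₗ[ℝ]
        EuclideanSpace ℝ (Fin n) →L[ℝ] ℝ) := by
      rw [injective_iff_map_eq_zero]
      intro w hw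
      by_contra hne
      have h1 := hF.phaseDeriv₂_energy_pos hΩ hp.1 hp.2 hne
      have h2 : g p w w = 0 := by
        rw [show g p w = 0 from hw]
        rfl
      exact h1.ne' h2
    have hdim : Module.finrank ℝ (EuclideanSpace ℝ (Fin n)) =
        Module.finrank ℝ (EuclideanSpace ℝ (Fin n) →L[ℝ] ℝ) :=
      (InnerProductSpace.toDual ℝ (EuclideanSpace ℝ (Fin n))).toLinearEquiv.finrank_eq
    exact ⟨((g p : EuclideanSpace ℝ (Fin n) →ₗ[ℝ]
      EuclideanSpace ℝ (Fin n) →L[ℝ] ℝ).linearEquivOfInjective hinj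
        hdim).toContinuousLinearEquiv, by ext; rfl⟩
  have hg : ContDiffOn ℝ ∞ g U :=
    contDiffOn_const.clm_comp (hD2.clm_comp contDiffOn_const)
  have hR : ContDiffOn ℝ ∞ R U :=
    (contDiffOn_const.clm_apply hD1).sub (contDiffOn_const.clm_apply
      (hD2.clm_apply (contDiffOn_snd.prodMk contDiffOn_const)))
  have hZ : ContDiffOn ℝ ∞ Z U := by
    refine ContDiffOn.clm_apply (fun p hp => ?_) hR
    exact ((hinv p hp).contDiffAt_map_inverse.comp p
      (hg.contDiffAt (hUo.mem_nhds hp))).contDiffWithinAt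
  have hEL : ∀ p ∈ U, ∀ w, phaseDeriv₂ L p (p.2, Z p) (0, w) = phaseDeriv L p (w, 0) := by
    intro p hp w
    have h1 : g p (Z p) = R p := (hinv p hp).self_apply_inverse _
    have h2 : phaseDeriv₂ L p (0, Z p) (0, w) =
        phaseDeriv L p (w, 0) - phaseDeriv₂ L p (p.2, 0) (0, w) := congr($h1 w)
    have h3 : ((p.2, Z p) : EuclideanSpace ℝ (Fin n) × EuclideanSpace ℝ (Fin n)) =
        (p.2, 0) + (0, Z p) := by simp
    rw [h3, map_add, add_apply, h2]
    ring
  have hXsm : ContDiffOn ℝ ∞ (fun p : EuclideanSpace ℝ (Fin n) × EuclideanSpace ℝ (Fin n) =>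
      (p.2, Z p)) U := contDiffOn_snd.prodMk hZ
  have hmem : (x, y) ∈ U := ⟨hx, hy⟩
  obtain ⟨α, hα0, ε₀, hε₀, hα⟩ :=
    ((hXsm.contDiffAt (hUo.mem_nhds hmem)).of_le
      (by simp)).exists_forall_mem_closedBall_exists_eq_forall_mem_Ioo_hasDerivAt₀ 0
  have hαc : ContinuousAt α 0 := (hα 0 (by simpa using hε₀)).continuousAt
  have hαU : ∀ᶠ t in 𝓝 (0 : ℝ), α t ∈ U := hαc (hUo.mem_nhds (by rwa [hα0]))
  obtain ⟨ε₁, hε₁, hball⟩ := Metric.eventually_nhds_iff.1 hαU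
  set ε := min ε₀ ε₁ with hε
  have hεpos : 0 < ε := lt_min hε₀ hε₁
  have hderiv : ∀ t ∈ Ioo (-ε) ε, HasDerivAt α ((α t).2, Z (α t)) t := by
    intro t ht
    refine hα t ⟨?_, ?_⟩ <;> linarith [ht.1, ht.2, min_le_left ε₀ ε₁]
  have hin : ∀ t ∈ Ioo (-ε) ε, α t ∈ U := by
    intro t ht
    refine hball ?_
    rw [Real.dist_eq, sub_zero, abs_lt]
    constructor <;> linarith [ht.1, ht.2, min_le_right ε₀ ε₁]
  have hd1 : ∀ t ∈ Ioo (-ε) ε, HasDerivAt (fun t => (α t).1) (α t).2 t := fun t ht =>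
    (ContinuousLinearMap.fst ℝ (EuclideanSpace ℝ (Fin n))
      (EuclideanSpace ℝ (Fin n))).hasFDerivAt.comp_hasDerivAt t (hderiv t ht)
  have hd2 : ∀ t ∈ Ioo (-ε) ε, HasDerivAt (fun t => (α t).2) (Z (α t)) t := fun t ht =>
    (ContinuousLinearMap.snd ℝ (EuclideanSpace ℝ (Fin n))
      (EuclideanSpace ℝ (Fin n))).hasFDerivAt.comp_hasDerivAt t (hderiv t ht)
  have hcd : ∀ t ∈ Ioo (-ε) ε, deriv (fun t => (α t).1) t = (α t).2 := fun t ht => (hd1 t ht).deriv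
  have hαcont : ContinuousOn α (Ioo (-ε) ε) := fun t ht =>
    (hderiv t ht).continuousAt.continuousWithinAt
  have h0 : (0 : ℝ) ∈ Ioo (-ε) ε := ⟨by linarith, hεpos⟩
  refine ⟨fun t => (α t).1, ε, hεpos, ⟨fun t ht => (hin t ht).1, ?_, ?_, ?_⟩, by simp [hα0],
    by rw [hcd 0 h0, hα0]⟩
  · have h1 : ContDiffOn ℝ 1 (fun t => (α t).2) (Ioo (-ε) ε) := by
      rw [show (1 : WithTop ℕ∞) = 0 + 1 by simp, contDiffOn_succ_iff_deriv_of_isOpen isOpen_Ioo]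
      refine ⟨fun t ht => (hd2 t ht).differentiableAt.differentiableWithinAt, by simp, ?_⟩
      rw [contDiffOn_zero]
      exact (hZ.continuousOn.comp hαcont hin).congr fun t ht => (hd2 t ht).deriv
    rw [show (2 : WithTop ℕ∞) = 1 + 1 by norm_num, contDiffOn_succ_iff_deriv_of_isOpen isOpen_Ioo]
    exact ⟨fun t ht => (hd1 t ht).differentiableAt.differentiableWithinAt, by simp,
      h1.congr hcd⟩
  · intro t ht
    rw [hcd t ht]
    exact (hin t ht).2
  · intro t ht w
    rw [hcd t ht, hS.fderiv_fst hΩ (hin t ht).1 (hin t ht).2]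
    have h1 := (hS.hasDerivAt_phaseDeriv_comp hΩ (hd1 t ht) (hd2 t ht) (hin t ht).1
      (hin t ht).2).clm_apply
      (hasDerivAt_const t ((0, w) : EuclideanSpace ℝ (Fin n) × EuclideanSpace ℝ (Fin n)))
    have h2 : (fun τ => phaseDeriv L ((α τ).1, (α τ).2) (0, w)) =ᶠ[𝓝 t]
        fun τ => fderiv ℝ (fun y => L (α τ).1 y) (deriv (fun t => (α t).1) τ) w := by
      filter_upwards [isOpen_Ioo.mem_nhds ht] with τ hτ
      rw [hcd τ hτ, hS.fderiv_snd hΩ (hin τ hτ).1 (hin τ hτ).2]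
      simp
    refine (h1.congr_of_eventuallyEq h2.symm).congr_deriv ?_
    rw [map_zero, add_zero]
    exact hEL _ (hin t ht) w

/-- If the points of a curve are collinear, so are its velocities and accelerations. -/
lemma exists_deriv_deriv_eq_smul_of_collinear {c : ℝ → EuclideanSpace ℝ (Fin n)} {a b t : ℝ}
    (hc : ContDiffOn ℝ 2 c (Ioo a b)) (hcol : Collinear ℝ (c '' Ioo a b)) (ht : t ∈ Ioo a b)
    (hne : deriv c t ≠ 0) : ∃ l : ℝ, deriv (deriv c) t = l • deriv c t := by
  obtain ⟨p, d, hd⟩ := (collinear_iff_exists_forall_eq_smul_vadd _).1 hcol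
  set K : Submodule ℝ (EuclideanSpace ℝ (Fin n)) := Submodule.span ℝ {d} with hK
  have hclosed : IsClosed (K : Set (EuclideanSpace ℝ (Fin n))) := K.closed_of_finiteDimensional
  -- a curve that stays in a closed subspace has its derivative there
  have key : ∀ (v : ℝ → EuclideanSpace ℝ (Fin n)) (v' : EuclideanSpace ℝ (Fin n)) (s : ℝ),
      s ∈ Ioo a b → HasDerivAt v v' s → (∀ τ ∈ Ioo a b, v τ - v s ∈ K) → v' ∈ K := by
    intro v v' s hs hv hmem
    refine hclosed.mem_of_tendsto hv.tendsto_slope ?_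
    filter_upwards [mem_nhdsWithin_of_mem_nhds (isOpen_Ioo.mem_nhds hs)] with τ hτ
    exact K.smul_mem _ (hmem τ hτ)
  have hpt : ∀ τ ∈ Ioo a b, c τ - p ∈ K := by
    intro τ hτ
    obtain ⟨r, hr⟩ := hd (c τ) (mem_image_of_mem c hτ)
    rw [hr, vadd_eq_add, add_sub_cancel_right]
    exact K.smul_mem _ (Submodule.mem_span_singleton_self d)
  have h1 : ∀ s ∈ Ioo a b, deriv c s ∈ K := fun s hs =>
    key c _ s hs (hasDerivAt_and_deriv_of_contDiffOn_two hc hs).1 fun τ hτ => by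
      simpa using K.sub_mem (hpt τ hτ) (hpt s hs)
  have h2 : deriv (deriv c) t ∈ K :=
    key (deriv c) _ t ht (hasDerivAt_and_deriv_of_contDiffOn_two hc ht).2 fun τ hτ =>
      K.sub_mem (h1 τ hτ) (h1 t ht)
  obtain ⟨r, hr⟩ := Submodule.mem_span_singleton.1 (h1 t ht)
  obtain ⟨s, hs⟩ := Submodule.mem_span_singleton.1 h2
  have hr0 : r ≠ 0 := by
    rintro rfl
    exact hne (by rw [← hr, zero_smul])
  exact ⟨s / r, by rw [← hr, ← hs, smul_smul, div_mul_cancel₀ _ hr0]⟩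

lemma IsProjectiveMetric.satisfiesHamel (hP : IsProjectiveMetric Ω F)
    (hF : IsFinslerMetricOn Ω F) (hΩ : IsOpen Ω) : SatisfiesHamel Ω F := by
  intro x hx y hy w
  obtain ⟨c, ε, hε, hc, hc0, hc1⟩ := hF.exists_geodesic hΩ hx hy
  have h0 : (0 : ℝ) ∈ Ioo (-ε) ε := ⟨by linarith, hε⟩
  obtain ⟨l, hl⟩ := exists_deriv_deriv_eq_smul_of_collinear hc.contDiffOn (hP c _ _ hc) h0
    (hc.regular 0 h0)
  have h1 := hc.phaseDeriv₂_energy_eq hF hΩ h0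
  rw [hl, hc0, hc1] at h1
  have h2 := hF.eulerLagrange_of_energy hΩ hx hy h1 w
  have h3 : ((y, l • y) : EuclideanSpace ℝ (Fin n) × EuclideanSpace ℝ (Fin n)) =
      (y, 0) + l • (0, y) := by simp
  have h4 : phaseDeriv₂ F (x, y) (0, y) (0, w) = 0 := by
    rw [hF.smoothOffZeroSection.phaseDeriv₂_symm hΩ hx hy, hF.phaseDeriv₂_euler hΩ hx hy,
      Prod.mk_zero_zero, map_zero]
  rw [h3, map_add, map_smul, add_apply, smul_apply, h4, smul_zero, add_zero] at h2
  exact h2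

end Geodesics

/-! ### From the formula to Hamel's equations -/

section Profile

variable {n : ℕ} {Ω : Set (EuclideanSpace ℝ (Fin n))}
  {F : EuclideanSpace ℝ (Fin n) → EuclideanSpace ℝ (Fin n) → ℝ}
  {x y z : EuclideanSpace ℝ (Fin n)} {f : ℝ → ℝ}

/-- The derivative of `F` in `y`, in the directions orthogonal to `x`, is the one of
`|y|` multiplied by a function of the distance `√(r² - v²/u²)` from the origin to the line through
`x` in the direction of `y`. With `F = φ(r, u, v)` this means `∂φ/∂u = f(v²/u² - r²)`. -/
def HasTransversalProfile (Ω : Set (EuclideanSpace ℝ (Fin n)))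
    (F : EuclideanSpace ℝ (Fin n) → EuclideanSpace ℝ (Fin n) → ℝ) (f : ℝ → ℝ) : Prop :=
  ∀ x ∈ Ω, ∀ y, y ≠ 0 → ∀ z, inner ℝ x z = (0 : ℝ) →
    phaseDeriv F (x, y) (0, z) =
      f ((inner ℝ x y : ℝ) ^ 2 / ‖y‖ ^ 2 - ‖x‖ ^ 2) * ((inner ℝ y z : ℝ) / ‖y‖)

lemma hasDerivAt_norm_add_smul (hy : y ≠ 0) (z : EuclideanSpace ℝ (Fin n)) :
    HasDerivAt (fun s : ℝ => ‖y + s • z‖) ((inner ℝ y z : ℝ) / ‖y‖) 0 := by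
  have hv : HasDerivAt (fun s : ℝ => y + s • z) z 0 := by
    simpa using ((hasDerivAt_id (0 : ℝ)).smul_const z).const_add y
  have h0 : ‖y‖ ≠ 0 := norm_ne_zero_iff.2 hy
  have h1 := hv.norm_sq.sqrt (by simpa using h0)
  simp only [Real.sqrt_sq (norm_nonneg _), zero_smul, add_zero] at h1
  refine h1.congr_deriv ?_
  field_simp

lemma hasTransversalProfile_of_formula (hS : SmoothOffZeroSection Ω F) (hΩ : IsOpen Ω)
    {g : ℝ → ℝ} {Φ : ℝ → ℝ → ℝ → ℝ} (hΦ : IsAntiderivativeInU Ω f Φ)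
    (hFΦ : ∀ x ∈ Ω, ∀ y, y ≠ 0 → F x y = Φ ‖x‖ ‖y‖ (inner ℝ x y) + g ‖x‖ * inner ℝ x y) :
    HasTransversalProfile Ω F f := by
  intro x hx y hy z hz
  have hv : HasDerivAt (fun s : ℝ => y + s • z) z 0 := by
    simpa using ((hasDerivAt_id (0 : ℝ)).smul_const z).const_add y
  have hinner : ∀ s : ℝ, (inner ℝ x (y + s • z) : ℝ) = inner ℝ x y := by
    intro s
    rw [inner_add_right, inner_smul_right, hz, mul_zero, add_zero]
  have hne : ∀ᶠ s : ℝ in 𝓝 0, y + s • z ≠ 0 :=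
    hv.continuousAt.eventually_ne (by simpa using hy)
  have h1 := hS.hasDerivAt_comp hΩ (hasDerivAt_const (0 : ℝ) x) hv hx (by simpa using hy)
  have hΦ' := hΦ x hx ‖y + (0 : ℝ) • z‖ (inner ℝ x y) (norm_pos_iff.2 (by simpa using hy))
    (by simpa using abs_real_inner_le_norm x y)
  have hmaps : MapsTo (fun s : ℝ => ‖y + s • z‖) {s | y + s • z ≠ 0}
      {w : ℝ | 0 < w ∧ |(inner ℝ x y : ℝ)| ≤ ‖x‖ * w} := fun s hs =>
    ⟨norm_pos_iff.2 hs, by rw [← hinner s]; exact abs_real_inner_le_norm _ _⟩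
  have h2 := ((hΦ'.comp (0 : ℝ) (hasDerivAt_norm_add_smul hy z).hasDerivWithinAt
    hmaps).hasDerivAt hne).add_const (g ‖x‖ * (inner ℝ x y : ℝ))
  have h3 : (fun s : ℝ => F x (y + s • z)) =ᶠ[𝓝 0] fun s : ℝ =>
      ((fun w => Φ ‖x‖ w (inner ℝ x y)) ∘ fun s : ℝ => ‖y + s • z‖) s +
        g ‖x‖ * (inner ℝ x y : ℝ) := by
    filter_upwards [hne] with s hs
    rw [hFΦ x hx _ hs, hinner]
    rfl
  simpa using h1.unique (h2.congr_of_eventuallyEq h3)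

/-- By the transversal profile, the angular momentum `f(v²/u² - r²) ⟨y, J x⟩ / u` is constant along
straight lines. Together with the invariance under rotations this gives Hamel's equations in the
directions orthogonal to `x`. -/
lemma HasTransversalProfile.hamel_of_orthogonal (hf : HasTransversalProfile Ω F f)
    (hsym : IsSphericallySymmetric Ω F) (hS : SmoothOffZeroSection Ω F) (hΩ : IsOpen Ω)
    (hx : x ∈ Ω) (hy : y ≠ 0) (hx0 : x ≠ 0) {w : EuclideanSpace ℝ (Fin n)}
    (hw : inner ℝ x w = (0 : ℝ)) :
    phaseDeriv₂ F (x, y) (y, 0) (0, w) = phaseDeriv F (x, y) (w, 0) := by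
  set J := rotationGenerator x w with hJ
  have hc : Continuous fun t : ℝ => x + t • y := by fun_prop
  have h1 := hS.hasDerivAt_angularMomentum hΩ J (t := 0) (by simpa using hx) hy
  have hyn : ‖y‖ ≠ 0 := norm_ne_zero_iff.2 hy
  have h2 : (fun t : ℝ => phaseDeriv F (x + t • y, y) (0, J (x + t • y))) =ᶠ[𝓝 0]
      fun _ => f ((inner ℝ x y : ℝ) ^ 2 / ‖y‖ ^ 2 - ‖x‖ ^ 2) * ((inner ℝ y (J x) : ℝ) / ‖y‖) := by
    filter_upwards [hc.continuousAt.eventually_mem (hΩ.mem_nhds (by simpa using hx))] with t ht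
    rw [hf _ ht y hy _ (inner_rotationGenerator_self _ _ _)]
    congr 2
    · rw [inner_add_left, real_inner_smul_left, real_inner_self_eq_norm_sq, norm_add_sq_real,
        inner_smul_right, norm_smul, mul_pow, Real.norm_eq_abs, sq_abs]
      field_simp
      ring
    · rw [map_add, map_smul, inner_add_right, inner_smul_right, inner_rotationGenerator_self,
        mul_zero, add_zero]
  have h3 := h1.unique ((hasDerivAt_const _ _).congr_of_eventuallyEq h2)
  simp only [zero_smul, add_zero] at h3
  have h4 := hsym.phaseDeriv_rotationGenerator hS hΩ hx0 hw hx hy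
  have h5 : ((J x, J y) : EuclideanSpace ℝ (Fin n) × EuclideanSpace ℝ (Fin n)) =
      (J x, 0) + (0, J y) := by simp
  have hJx : J x = ‖x‖ ^ 2 • w := by
    rw [hJ, rotationGenerator_apply, real_inner_self_eq_norm_sq, real_inner_comm, hw, zero_smul,
      sub_zero]
  have hsm : ∀ a : EuclideanSpace ℝ (Fin n), ((0, ‖x‖ ^ 2 • a) :
      EuclideanSpace ℝ (Fin n) × EuclideanSpace ℝ (Fin n)) = ‖x‖ ^ 2 • (0, a) := by simp
  have hsm' : ∀ a : EuclideanSpace ℝ (Fin n), ((‖x‖ ^ 2 • a, 0) :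
      EuclideanSpace ℝ (Fin n) × EuclideanSpace ℝ (Fin n)) = ‖x‖ ^ 2 • (a, 0) := by simp
  rw [h5, map_add] at h4
  have h6 : phaseDeriv₂ F (x, y) (y, 0) (0, J x) = phaseDeriv F (x, y) (J x, 0) := by linarith
  rw [hJx, hsm, hsm', map_smul, map_smul, smul_eq_mul, smul_eq_mul] at h6
  exact mul_left_cancel₀ (pow_ne_zero 2 (norm_ne_zero_iff.2 hx0)) h6

/-- Hamel's equations hold in the direction `y` by homogeneity and in the directions orthogonal to
`x` by the transversal profile; these span when `⟨x, y⟩ ≠ 0`. The other case follows by continuity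
along the line through `x` in the direction of `y`. -/
lemma HasTransversalProfile.satisfiesHamel (hf : HasTransversalProfile Ω F f)
    (hsym : IsSphericallySymmetric Ω F) (hF : IsFinslerMetricOn Ω F) (hΩ : IsOpen Ω) :
    SatisfiesHamel Ω F := by
  have hS := hF.smoothOffZeroSection
  have hgen : ∀ x ∈ Ω, ∀ y, y ≠ 0 → (inner ℝ x y : ℝ) ≠ 0 → ∀ w,
      phaseDeriv₂ F (x, y) (y, 0) (0, w) = phaseDeriv F (x, y) (w, 0) := by
    intro x hx y hy hxy w
    have hx0 : x ≠ 0 := by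
      rintro rfl
      exact hxy (inner_zero_left _)
    set l : ℝ := (inner ℝ x w : ℝ) / inner ℝ x y with hl
    have horth : (inner ℝ x (w - l • y) : ℝ) = 0 := by
      rw [inner_sub_right, inner_smul_right, hl, div_mul_cancel₀ _ hxy, sub_self]
    have h1 := hf.hamel_of_orthogonal hsym hS hΩ hx hy hx0 horth
    have h2 := hF.phaseDeriv₂_euler hΩ hx hy y 0
    have h3 : ((0, w) : EuclideanSpace ℝ (Fin n) × EuclideanSpace ℝ (Fin n)) =
        (0, w - l • y) + l • (0, y) := by simp
    have h4 : ((w, 0) : EuclideanSpace ℝ (Fin n) × EuclideanSpace ℝ (Fin n)) =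
        (w - l • y, 0) + l • (y, 0) := by simp
    rw [h3, h4, map_add, map_add, map_smul, map_smul, h1, h2]
  intro x hx y hy w
  have hyn : ‖y‖ ≠ 0 := norm_ne_zero_iff.2 hy
  have hc : Continuous fun t : ℝ => ((x + t • y, y) :
    EuclideanSpace ℝ (Fin n) × EuclideanSpace ℝ (Fin n)) := by fun_prop
  have hmem : ((x + (0 : ℝ) • y, y) : EuclideanSpace ℝ (Fin n) × EuclideanSpace ℝ (Fin n)) ∈
      Ω ×ˢ ({0}ᶜ : Set (EuclideanSpace ℝ (Fin n))) := ⟨by simpa using hx, hy⟩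
  have hnhds := (hΩ.prod isOpen_compl_singleton).mem_nhds hmem
  have hcont : ContinuousAt (fun t : ℝ => phaseDeriv₂ F (x + t • y, y) (y, 0) (0, w) -
      phaseDeriv F (x + t • y, y) (w, 0)) 0 := by
    have h1 : ContinuousAt (fun t : ℝ => phaseDeriv₂ F (x + t • y, y)) 0 :=
      ContinuousAt.comp (f := fun t : ℝ => (x + t • y, y))
        ((hS.contDiffOn_phaseDeriv₂ hΩ).contDiffAt hnhds).continuousAt hc.continuousAt
    have h2 : ContinuousAt (fun t : ℝ => phaseDeriv F (x + t • y, y)) 0 :=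
      ContinuousAt.comp (f := fun t : ℝ => (x + t • y, y))
        ((hS.contDiffOn_phaseDeriv hΩ).contDiffAt hnhds).continuousAt hc.continuousAt
    exact ((h1.clm_apply continuousAt_const).clm_apply continuousAt_const).sub
      (h2.clm_apply continuousAt_const)
  have hev : (fun t : ℝ => phaseDeriv₂ F (x + t • y, y) (y, 0) (0, w) -
      phaseDeriv F (x + t • y, y) (w, 0)) =ᶠ[𝓝[≠] 0] fun _ => 0 := by
    -- `⟨x + t y, y⟩` vanishes for exactly one `t`
    have hlin : ∀ᶠ t : ℝ in 𝓝[≠] 0, (inner ℝ (x + t • y) y : ℝ) ≠ 0 := by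
      by_cases h0 : (inner ℝ x y : ℝ) = 0
      · filter_upwards [self_mem_nhdsWithin] with t ht
        rw [inner_add_left, real_inner_smul_left, h0, real_inner_self_eq_norm_sq, zero_add]
        exact mul_ne_zero ht (pow_ne_zero 2 hyn)
      · have hcont : Continuous fun t : ℝ => (inner ℝ (x + t • y) y : ℝ) := by fun_prop
        exact mem_nhdsWithin_of_mem_nhds (hcont.continuousAt.eventually_ne (by simpa using h0))
    filter_upwards [hlin, mem_nhdsWithin_of_mem_nhds (hc.continuousAt.eventually_mem hnhds)]
      with t ht ht'
    exact sub_eq_zero.2 (hgen _ ht'.1 y hy ht w)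
  have h0 := tendsto_nhds_unique (hcont.tendsto.mono_left nhdsWithin_le_nhds)
    (tendsto_const_nhds.congr' hev.symm)
  simp only [zero_smul, add_zero] at h0
  exact sub_eq_zero.1 h0

end Profile

/-! ### The normalized antiderivative -/

section NormalizedAntiderivative

lemma isBigO_truncated_sub {f : ℝ → ℝ} {r : ℝ} (v : ℝ)
    (hfd : DifferentiableWithinAt ℝ f (Icc (-r ^ 2) 0) (-r ^ 2)) :
    (fun w : ℝ => f (min (v ^ 2 / w ^ 2) (r ^ 2) - r ^ 2) - f (-r ^ 2)) =O[atTop]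
      fun w : ℝ => w ^ (-2 : ℝ) := by
  have hlim : Tendsto (fun w : ℝ => min (v ^ 2 / w ^ 2) (r ^ 2) - r ^ 2) atTop
      (𝓝[Icc (-r ^ 2) 0] (-r ^ 2)) := by
    refine tendsto_nhdsWithin_iff.2 ⟨?_, .of_forall fun w => ⟨?_, ?_⟩⟩
    · have h1 : Tendsto (fun w : ℝ => v ^ 2 / w ^ 2) atTop (𝓝 0) :=
        tendsto_const_nhds.div_atTop (tendsto_pow_atTop two_ne_zero)
      have h2 := (h1.min (tendsto_const_nhds (x := r ^ 2))).sub (tendsto_const_nhds (x := r ^ 2))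
      rwa [min_eq_left (sq_nonneg r), zero_sub] at h2
    · have : 0 ≤ min (v ^ 2 / w ^ 2) (r ^ 2) := le_min (by positivity) (sq_nonneg r)
      linarith
    · linarith [min_le_right (v ^ 2 / w ^ 2) (r ^ 2)]
  refine (hfd.isBigO_sub.comp_tendsto hlim).trans ?_
  refine Asymptotics.IsBigO.of_bound (v ^ 2) ?_
  filter_upwards [eventually_gt_atTop (0 : ℝ)] with w hw
  have h0 : 0 ≤ min (v ^ 2 / w ^ 2) (r ^ 2) := le_min (by positivity) (sq_nonneg r)
  rw [Function.comp_apply, sub_neg_eq_add, sub_add_cancel, Real.norm_of_nonneg h0,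
    Real.norm_of_nonneg (by positivity), Real.rpow_neg hw.le, ← div_eq_mul_inv]
  simp

/-- The normalized antiderivative, for fixed `r` and `v`, extends from `u ≥ |v| / r` to an
antiderivative of a continuous function on all of `u > 0`. Here `v²/u² - r²` is truncated at `0`,
as `f` is arbitrary on positive numbers. Its constant of integration is fixed at `u = ∞`. -/
lemma exists_extension_normalizedAntiderivative {f : ℝ → ℝ} {r : ℝ} (v : ℝ) (hr : 0 ≤ r)
    (hfc : ContinuousOn f (Icc (-r ^ 2) 0))
    (hfd : DifferentiableWithinAt ℝ f (Icc (-r ^ 2) 0) (-r ^ 2)) :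
    ∃ N : ℝ → ℝ, (∀ u, 0 < u → |v| ≤ r * u → normalizedAntiderivative f r u v = N u) ∧
      (∀ u, 0 < u → HasDerivAt N (f (min (v ^ 2 / u ^ 2) (r ^ 2) - r ^ 2)) u) ∧
      Tendsto (fun u => N u - f (-r ^ 2) * u) atTop (𝓝 0) := by
  set h : ℝ → ℝ := fun w => f (min (v ^ 2 / w ^ 2) (r ^ 2) - r ^ 2) - f (-r ^ 2) with hh
  have hcont : ContinuousOn h (Ioi 0) := by
    refine (hfc.comp ?_ ?_).sub continuousOn_const
    · refine ((continuousOn_const.div (by fun_prop) fun w hw => ?_).inf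
        continuousOn_const).sub continuousOn_const
      exact pow_ne_zero 2 (ne_of_gt hw)
    · intro w hw
      have h0 : 0 ≤ min (v ^ 2 / w ^ 2) (r ^ 2) := le_min (by positivity) (sq_nonneg r)
      exact ⟨by linarith, by linarith [min_le_right (v ^ 2 / w ^ 2) (r ^ 2)]⟩
  have hint : ∀ u, 0 < u → IntegrableOn h (Ioi u) := by
    intro u hu
    refine (LocallyIntegrableOn.integrableOn_of_isBigO_atTop ?_ (isBigO_truncated_sub v hfd)
      (integrableAtFilter_rpow_atTop_iff.2 (by norm_num))).mono_set
        (Ioi_subset_Ici_self : Ioi u ⊆ Ici u)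
    exact (hcont.mono fun w hw => lt_of_lt_of_le hu hw).locallyIntegrableOn measurableSet_Ici
  refine ⟨fun u => f (-r ^ 2) * u - ∫ w in Ioi u, h w, ?_, ?_, ?_⟩
  · intro u hu huv
    rw [normalizedAntiderivative]
    congr 1
    refine setIntegral_congr_fun measurableSet_Ioi fun w hw => ?_
    have hw0 : 0 < w := hu.trans hw
    have h1 : v ^ 2 ≤ (r * w) ^ 2 := by
      rw [← sq_abs]
      exact pow_le_pow_left₀ (abs_nonneg v)
        (huv.trans (mul_le_mul_of_nonneg_left (le_of_lt hw) hr)) 2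
    have h2 : v ^ 2 / w ^ 2 ≤ r ^ 2 := by
      rw [div_le_iff₀ (by positivity), ← mul_pow]
      exact h1
    simp only [hh, min_eq_left h2]
  · intro u hu
    have hsub : ∀ᶠ b in 𝓝 u, ∫ w in Ioi b, h w =
        (∫ w in Ioi (u / 2), h w) - ∫ w in (u / 2)..b, h w := by
      filter_upwards [lt_mem_nhds (half_lt_self hu)] with b hb
      rw [← intervalIntegral.integral_interval_add_Ioi (hint (u / 2) (half_pos hu))
        (hint b ((half_pos hu).trans hb))]
      ring
    have hii : IntervalIntegrable h volume (u / 2) u :=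
      (hcont.mono fun w hw => by
        rw [uIcc_of_le (half_lt_self hu).le] at hw
        exact (half_pos hu).trans_le hw.1).intervalIntegrable
    have h1 : HasDerivAt (fun b => ∫ w in (u / 2)..b, h w) (h u) u :=
      intervalIntegral.integral_hasDerivAt_right hii
        (hcont.stronglyMeasurableAtFilter isOpen_Ioi u hu)
        (hcont.continuousAt (Ioi_mem_nhds hu))
    have h2 : HasDerivAt (fun b => ∫ w in Ioi b, h w) (-h u) u :=
      (h1.const_sub _).congr_of_eventuallyEq hsub
    refine (((hasDerivAt_id u).const_mul (f (-r ^ 2))).sub h2).congr_deriv ?_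
    simp only [hh]
    ring
  · have := (tendsto_integral_Ioi_zero (μ := volume) (f := h) tendsto_id).neg
    simpa using this

variable {n : ℕ} {Ω : Set (EuclideanSpace ℝ (Fin n))}
  {F : EuclideanSpace ℝ (Fin n) → EuclideanSpace ℝ (Fin n) → ℝ} {f g : ℝ → ℝ}

lemma IsSphericallySymmetric.Icc_subset_image (hsym : IsSphericallySymmetric Ω F)
    (hΩ : Convex ℝ Ω) {x : EuclideanSpace ℝ (Fin n)} (hx : x ∈ Ω) :
    Icc (-‖x‖ ^ 2) 0 ⊆ (fun x : EuclideanSpace ℝ (Fin n) => -‖x‖ ^ 2) '' Ω := by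
  rintro s ⟨hs1, hs2⟩
  rcases eq_or_ne x 0 with rfl | hne
  · refine ⟨0, hx, ?_⟩
    simp only [norm_zero] at hs1 ⊢
    linarith
  · have hn : 0 < ‖x‖ := norm_pos_iff.2 hne
    have hle : √(-s) ≤ ‖x‖ := Real.sqrt_le_iff.2 ⟨hn.le, by linarith⟩
    have hnorm : ‖(√(-s) / ‖x‖) • x‖ = √(-s) := by
      rw [norm_smul, norm_div, norm_norm, div_mul_cancel₀ _ hn.ne',
        Real.norm_of_nonneg (Real.sqrt_nonneg _)]
    refine ⟨(√(-s) / ‖x‖) • x, hsym.mem_of_norm_le hΩ hx (by rwa [hnorm]), ?_⟩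
    simp only [hnorm]
    rw [Real.sq_sqrt (by linarith), neg_neg]

lemma exists_extension_normalizedAntiderivative_norm (hsym : IsSphericallySymmetric Ω F)
    (hΩ : Convex ℝ Ω)
    (hf : ContDiffOn ℝ ∞ f ((fun x : EuclideanSpace ℝ (Fin n) => -‖x‖ ^ 2) '' Ω))
    {x : EuclideanSpace ℝ (Fin n)} (hx : x ∈ Ω) (v : ℝ) :
    ∃ N : ℝ → ℝ,
      (∀ u, 0 < u → |v| ≤ ‖x‖ * u → normalizedAntiderivative f ‖x‖ u v = N u) ∧
      (∀ u, 0 < u → HasDerivAt N (f (min (v ^ 2 / u ^ 2) (‖x‖ ^ 2) - ‖x‖ ^ 2)) u) ∧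
      Tendsto (fun u => N u - f (-‖x‖ ^ 2) * u) atTop (𝓝 0) := by
  have hsub := hsym.Icc_subset_image hΩ hx
  refine exists_extension_normalizedAntiderivative v (norm_nonneg x) (hf.continuousOn.mono hsub)
    ((hf.differentiableOn (by simp) _ (mem_image_of_mem _ hx)).mono hsub)

lemma min_sq_div_sq_eq {r u v : ℝ} (hu : 0 < u) (huv : |v| ≤ r * u) :
    min (v ^ 2 / u ^ 2) (r ^ 2) = v ^ 2 / u ^ 2 := by
  refine min_eq_left ?_
  rw [div_le_iff₀ (by positivity), ← mul_pow, ← sq_abs]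
  exact pow_le_pow_left₀ (abs_nonneg v) huv 2

lemma isAntiderivativeInU_normalizedAntiderivative (hsym : IsSphericallySymmetric Ω F)
    (hΩ : Convex ℝ Ω)
    (hf : ContDiffOn ℝ ∞ f ((fun x : EuclideanSpace ℝ (Fin n) => -‖x‖ ^ 2) '' Ω)) :
    IsAntiderivativeInU Ω f (normalizedAntiderivative f) := by
  intro x hx u v hu huv
  obtain ⟨N, hN, hd, -⟩ := exists_extension_normalizedAntiderivative_norm hsym hΩ hf hx v
  have h1 := (hd u hu).hasDerivWithinAt (s := {w : ℝ | 0 < w ∧ |v| ≤ ‖x‖ * w})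
  rw [min_sq_div_sq_eq hu huv] at h1
  exact h1.congr (fun w hw => hN w hw.1 hw.2) (hN u hu huv)

end NormalizedAntiderivative

/-! ### From Hamel's equations to the formula -/

section Formula

variable {n : ℕ} {Ω : Set (EuclideanSpace ℝ (Fin n))}
  {F : EuclideanSpace ℝ (Fin n) → EuclideanSpace ℝ (Fin n) → ℝ}
  {e₁ e₂ : EuclideanSpace ℝ (Fin n)}

lemma IsSphericallySymmetric.apply_of_orthogonal (hsym : IsSphericallySymmetric Ω F)
    (hF : IsFinslerMetricOn Ω F) (h1 : ‖e₁‖ = 1) (h2 : ‖e₂‖ = 1) (h12 : inner ℝ e₁ e₂ = (0 : ℝ))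
    {x y : EuclideanSpace ℝ (Fin n)} (hx : x ∈ Ω) (hy : y ≠ 0) (hxy : inner ℝ x y = (0 : ℝ)) :
    F x y = ‖y‖ * F (‖x‖ • e₂) e₁ := by
  have hn : 0 < ‖y‖ := norm_pos_iff.2 hy
  have hnx : ‖x‖ = ‖‖x‖ • e₂‖ := by rw [norm_smul, norm_norm, h2, mul_one]
  rw [← hF.homogeneous _ (hsym.mem_of_norm_eq hx hnx) _ _ hn]
  refine hsym.apply_eq hx hnx (by rw [norm_smul, norm_norm, h1, mul_one]) ?_
  rw [hxy, inner_smul_right, real_inner_smul_left, real_inner_comm, h12, mul_zero, mul_zero]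

lemma norm_smul_add_smul_orthonormal (h1 : ‖e₁‖ = 1) (h2 : ‖e₂‖ = 1)
    (h12 : inner ℝ e₁ e₂ = (0 : ℝ)) (a b : ℝ) : ‖a • e₁ + b • e₂‖ = √(a ^ 2 + b ^ 2) := by
  rw [← Real.sqrt_sq (norm_nonneg (a • e₁ + b • e₂)), norm_add_sq_real, norm_smul, norm_smul,
    h1, h2, inner_smul_right, real_inner_smul_left, h12]
  congr 1
  simp

/-- The angular momentum in the plane of `e₁` and `e₂` takes the same value at `r e₂` and at the
foot of the perpendicular from the origin to the line through `r e₂` in the direction of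
`y = a e₁ + b e₂`. At the foot it is determined by Euler's identity. -/
lemma SatisfiesHamel.phaseDeriv_orthogonal (hH : SatisfiesHamel Ω F)
    (hsym : IsSphericallySymmetric Ω F) (hF : IsFinslerMetricOn Ω F) (hΩ : IsOpen Ω)
    (hconv : Convex ℝ Ω) (h1 : ‖e₁‖ = 1) (h2 : ‖e₂‖ = 1) (h12 : inner ℝ e₁ e₂ = (0 : ℝ))
    {r a b : ℝ} (hr : 0 < r) (ha : 0 < a) (hmem : r • e₂ ∈ Ω) :
    phaseDeriv F (r • e₂, a • e₁ + b • e₂) (0, e₁) =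
      a / √(a ^ 2 + b ^ 2) * F ((r * a / √(a ^ 2 + b ^ 2)) • e₂) e₁ := by
  set u := √(a ^ 2 + b ^ 2) with hu
  set y := a • e₁ + b • e₂ with hy
  have hupos : 0 < u := Real.sqrt_pos.2 (by positivity)
  have husq : u ^ 2 = a ^ 2 + b ^ 2 := Real.sq_sqrt (by positivity)
  have hyn : ‖y‖ = u := norm_smul_add_smul_orthonormal h1 h2 h12 a b
  have hy0 : y ≠ 0 := norm_pos_iff.1 (by rwa [hyn])
  have h21 : inner ℝ e₂ e₁ = (0 : ℝ) := by rw [real_inner_comm, h12]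
  have he2 : e₂ ≠ 0 := norm_pos_iff.1 (by rw [h2]; exact one_pos)
  have h11 : (inner ℝ e₁ e₁ : ℝ) = 1 := by rw [real_inner_self_eq_norm_sq, h1, one_pow]
  have h22 : (inner ℝ e₂ e₂ : ℝ) = 1 := by rw [real_inner_self_eq_norm_sq, h2, one_pow]
  have hJ : ∀ α β : ℝ, rotationGenerator e₂ e₁ (α • e₁ + β • e₂) = β • e₁ - α • e₂ := by
    intro α β
    simp only [rotationGenerator_apply, inner_add_right, inner_smul_right, h11, h22, h12, h21,
      mul_zero, mul_one, zero_add, add_zero]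
  -- the parameter of the foot of the perpendicular
  set t₀ : ℝ := -(r * b) / u ^ 2 with ht₀
  have hline : ∀ t : ℝ, r • e₂ + t • y = (t * a) • e₁ + (r + t * b) • e₂ := by
    intro t
    rw [hy]
    module
  have hfoot : r + t₀ * b = r * a ^ 2 / u ^ 2 := by
    rw [ht₀]
    field_simp
    rw [husq]
    ring
  have hfootn : ‖r • e₂ + t₀ • y‖ = r * a / u := by
    rw [hline, norm_smul_add_smul_orthonormal h1 h2 h12, hfoot,
      Real.sqrt_eq_iff_mul_self_eq (by positivity) (by positivity), ht₀]
    field_simp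
    rw [husq]
    ring
  have hau : a ≤ u := by
    rw [hu]
    exact Real.le_sqrt_of_sq_le (by nlinarith [sq_nonneg b])
  have hfootmem : r • e₂ + t₀ • y ∈ Ω := by
    refine hsym.mem_of_norm_le hconv hmem ?_
    rw [hfootn, norm_smul, h2, mul_one, Real.norm_of_nonneg hr.le, div_le_iff₀ hupos]
    exact mul_le_mul_of_nonneg_left hau hr.le
  set T : Set ℝ := {t | r • e₂ + t • y ∈ Ω} with hT
  have hTo : IsOpen T := hΩ.preimage (by fun_prop)
  have hTc : Convex ℝ T := by
    intro s hs t ht α β hα hβ hαβ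
    have := hconv hs ht hα hβ hαβ
    change r • e₂ + (α • s + β • t) • y ∈ Ω
    convert this using 1
    simp only [smul_add, smul_smul, smul_eq_mul, add_smul]
    nth_rw 1 [← one_mul r, ← hαβ]
    module
  have hder : ∀ t ∈ T, HasDerivAt (fun t : ℝ => phaseDeriv F (r • e₂ + t • y, y)
      (0, rotationGenerator e₂ e₁ (r • e₂ + t • y))) 0 t := fun t ht =>
    hH.hasDerivAt_angularMomentum_zero hsym hF.smoothOffZeroSection hΩ he2 h21 ht hy0
  have hconst := hTo.is_const_of_deriv_eq_zero hTc.isPreconnected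
    (fun t ht => (hder t ht).differentiableAt.differentiableWithinAt)
    (fun t ht => (hder t ht).deriv) (x := 0) (y := t₀) (by simpa [hT] using hmem) hfootmem
  have hJ0 : rotationGenerator e₂ e₁ (r • e₂ + (0 : ℝ) • y) = r • e₁ := by
    rw [hline, hJ]
    simp
  have hJt : rotationGenerator e₂ e₁ (r • e₂ + t₀ • y) = (r * a / u ^ 2) • y := by
    rw [hline, hJ, hfoot, ht₀, hy, smul_add, smul_smul, smul_smul, sub_eq_add_neg, ← neg_smul]
    congr 2 <;> field_simp
  have hsm : ∀ (l : ℝ) (z : EuclideanSpace ℝ (Fin n)), ((0, l • z) :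
      EuclideanSpace ℝ (Fin n) × EuclideanSpace ℝ (Fin n)) = l • (0, z) := by simp
  have horth : (inner ℝ (r • e₂ + t₀ • y) y : ℝ) = 0 := by
    rw [hline, hfoot, hy]
    simp only [inner_add_left, inner_add_right, inner_smul_right, real_inner_smul_left, h11, h22,
      h12, h21]
    rw [ht₀]
    field_simp
    ring
  simp only [hJ0, hJt, hsm, map_smul, smul_eq_mul] at hconst
  rw [hF.phaseDeriv_euler hΩ hfootmem hy0,
    hsym.apply_of_orthogonal hF h1 h2 h12 hfootmem hy0 horth, hyn, hfootn, zero_smul,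
    add_zero] at hconst
  refine mul_left_cancel₀ hr.ne' (hconst.trans ?_)
  field_simp

lemma tendsto_sub_sqrt_sq_add_sq (b : ℝ) :
    Tendsto (fun a : ℝ => a - √(a ^ 2 + b ^ 2)) atTop (𝓝 0) := by
  have h1 : Tendsto (fun a : ℝ => -(b ^ 2 / a)) atTop (𝓝 0) := by
    simpa using (tendsto_const_nhds (x := b ^ 2).div_atTop tendsto_id).neg
  refine tendsto_of_tendsto_of_tendsto_of_le_of_le' h1 tendsto_const_nhds ?_ ?_
  · filter_upwards [eventually_gt_atTop (0 : ℝ)] with a ha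
    have h2 : √(a ^ 2 + b ^ 2) ≤ a + b ^ 2 / a := by
      refine Real.sqrt_le_iff.2 ⟨by positivity, ?_⟩
      have h3 : (a + b ^ 2 / a) ^ 2 = a ^ 2 + 2 * b ^ 2 + (b ^ 2 / a) ^ 2 := by
        field_simp
        ring
      rw [h3]
      nlinarith [sq_nonneg b, sq_nonneg (b ^ 2 / a)]
    linarith
  · filter_upwards [eventually_gt_atTop (0 : ℝ)] with a ha
    have : a ≤ √(a ^ 2 + b ^ 2) := Real.le_sqrt_of_sq_le (by nlinarith [sq_nonneg b])
    linarith

/-- For fixed `x = r e₂`, and `y = a e₁ + b e₂` with fixed `b`, the functions `F` and `N` of `a`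
have the same derivative; the constant is found by letting `a` tend to infinity. -/
lemma SatisfiesHamel.apply_orthonormal (hH : SatisfiesHamel Ω F)
    (hsym : IsSphericallySymmetric Ω F) (hF : IsFinslerMetricOn Ω F) (hΩ : IsOpen Ω)
    (hconv : Convex ℝ Ω) (h1 : ‖e₁‖ = 1) (h2 : ‖e₂‖ = 1) (h12 : inner ℝ e₁ e₂ = (0 : ℝ))
    {r a b : ℝ} (hr : 0 < r) (ha : 0 ≤ a) (hab : a ≠ 0 ∨ b ≠ 0) (hmem : r • e₂ ∈ Ω)
    {f N : ℝ → ℝ} (hf : ∀ s, f s = F (√(-s) • e₂) e₁)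
    (hN : ∀ u, 0 < u → HasDerivAt N (f (min ((r * b) ^ 2 / u ^ 2) (r ^ 2) - r ^ 2)) u)
    (hNlim : Tendsto (fun u => N u - f (-r ^ 2) * u) atTop (𝓝 0)) :
    F (r • e₂) (a • e₁ + b • e₂) =
      N √(a ^ 2 + b ^ 2) + b * phaseDeriv F (r • e₂, e₁) (0, e₂) := by
  have hS := hF.smoothOffZeroSection
  have hfr : f (-r ^ 2) = F (r • e₂) e₁ := by rw [hf, neg_neg, Real.sqrt_sq hr.le]
  have he1 : e₁ ≠ 0 := norm_pos_iff.1 (by rw [h1]; exact one_pos)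
  have hne : ∀ a : ℝ, a ≠ 0 ∨ b ≠ 0 → 0 < a ^ 2 + b ^ 2 := by
    rintro a (h | h) <;> positivity
  have hy0 : ∀ a : ℝ, a ≠ 0 ∨ b ≠ 0 → a • e₁ + b • e₂ ≠ 0 := fun a h =>
    norm_pos_iff.1 (by
      rw [norm_smul_add_smul_orthonormal h1 h2 h12]
      exact Real.sqrt_pos.2 (hne a h))
  have hv : ∀ a : ℝ, HasDerivAt (fun a : ℝ => a • e₁ + b • e₂) e₁ a := fun a => by
    simpa using ((hasDerivAt_id a).smul_const e₁).add_const (b • e₂)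
  have hsq : ∀ a, a ≠ 0 ∨ b ≠ 0 →
      HasDerivAt (fun a : ℝ => √(a ^ 2 + b ^ 2)) (a / √(a ^ 2 + b ^ 2)) a := by
    intro a h
    refine ((((hasDerivAt_id a).pow 2).add_const (b ^ 2)).sqrt (hne a h).ne').congr_deriv ?_
    simp only [Pi.pow_apply, id_eq]
    have := (Real.sqrt_pos.2 (hne a h)).ne'
    field_simp
    simp
  set k : ℝ → ℝ := fun a => F (r • e₂) (a • e₁ + b • e₂) - N √(a ^ 2 + b ^ 2) with hk
  have hkF : ∀ a, a ≠ 0 ∨ b ≠ 0 → HasDerivAt (fun a : ℝ => F (r • e₂) (a • e₁ + b • e₂))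
      (phaseDeriv F (r • e₂, a • e₁ + b • e₂) (0, e₁)) a := fun a h =>
    hS.hasDerivAt_comp hΩ (c := fun _ => r • e₂) (hasDerivAt_const _ _) (hv a) hmem (hy0 a h)
  have hkN : ∀ a, a ≠ 0 ∨ b ≠ 0 → HasDerivAt (fun a : ℝ => N √(a ^ 2 + b ^ 2))
      (f (min ((r * b) ^ 2 / √(a ^ 2 + b ^ 2) ^ 2) (r ^ 2) - r ^ 2) *
        (a / √(a ^ 2 + b ^ 2))) a := fun a h =>
    (hN _ (Real.sqrt_pos.2 (hne a h))).comp a (hsq a h)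
  have hkd : ∀ a ∈ Ioi (0 : ℝ), HasDerivAt k 0 a := by
    intro a ha
    have h0 : a ≠ 0 ∨ b ≠ 0 := Or.inl (ne_of_gt ha)
    refine ((hkF a h0).sub (hkN a h0)).congr_deriv ?_
    have hu := Real.sqrt_pos.2 (hne a h0)
    have hu2 : √(a ^ 2 + b ^ 2) ^ 2 = a ^ 2 + b ^ 2 := Real.sq_sqrt (hne a h0).le
    have hle : (r * b) ^ 2 / √(a ^ 2 + b ^ 2) ^ 2 ≤ r ^ 2 := by
      rw [hu2, div_le_iff₀ (hne a h0)]
      nlinarith [mul_nonneg (sq_nonneg r) (sq_nonneg a)]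
    have harg : -((r * b) ^ 2 / √(a ^ 2 + b ^ 2) ^ 2 - r ^ 2) =
        (r * a / √(a ^ 2 + b ^ 2)) ^ 2 := by
      have := hne a h0
      rw [div_pow, hu2]
      field_simp
      ring
    rw [hH.phaseDeriv_orthogonal hsym hF hΩ hconv h1 h2 h12 hr ha hmem, min_eq_left hle, hf, harg,
      Real.sqrt_sq (div_nonneg (mul_nonneg hr.le (le_of_lt ha)) hu.le)]
    ring
  have hlim : Tendsto k atTop (𝓝 (b * phaseDeriv F (r • e₂, e₁) (0, e₂))) := by
    have hG : HasDerivAt (fun s : ℝ => F (r • e₂) (e₁ + s • (b • e₂)))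
        (b * phaseDeriv F (r • e₂, e₁) (0, e₂)) 0 := by
      have hv : HasDerivAt (fun s : ℝ => e₁ + s • (b • e₂)) (b • e₂) 0 := by
        simpa using ((hasDerivAt_id (0 : ℝ)).smul_const (b • e₂)).const_add e₁
      have := hS.hasDerivAt_comp hΩ (c := fun _ => r • e₂) (hasDerivAt_const _ _) hv hmem
        (by simpa using he1)
      refine this.congr_deriv ?_
      rw [zero_smul, add_zero, show ((0, b • e₂) : EuclideanSpace ℝ (Fin n) ×
        EuclideanSpace ℝ (Fin n)) = b • (0, e₂) by simp, map_smul, smul_eq_mul]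
    have hslope := hG.tendsto_slope_zero_right.comp tendsto_inv_atTop_nhdsGT_zero
    have hsqrt : Tendsto (fun a : ℝ => √(a ^ 2 + b ^ 2)) atTop atTop :=
      tendsto_atTop_mono (fun a => (le_abs_self a).trans
        (Real.le_sqrt_of_sq_le (by nlinarith [sq_nonneg b, sq_abs a]))) tendsto_id
    have h3 := (hslope.sub (hNlim.comp hsqrt)).add
      ((tendsto_sub_sqrt_sq_add_sq b).const_mul (F (r • e₂) e₁))
    rw [sub_zero, mul_zero, add_zero] at h3
    refine h3.congr' ?_
    filter_upwards [eventually_gt_atTop (0 : ℝ)] with a ha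
    have hhom : F (r • e₂) (a • e₁ + b • e₂) = a * F (r • e₂) (e₁ + a⁻¹ • (b • e₂)) := by
      rw [← hF.homogeneous _ hmem _ _ ha, smul_add, smul_smul, mul_inv_cancel₀ ha.ne', one_smul]
    simp only [hk, Function.comp_apply, hhom, zero_add, zero_smul, add_zero, inv_inv, smul_eq_mul,
      hfr]
    ring
  have hpos : ∀ a ∈ Ioi (0 : ℝ), k a = b * phaseDeriv F (r • e₂, e₁) (0, e₂) := by
    intro a ha
    refine tendsto_nhds_unique (tendsto_const_nhds.congr' ?_) hlim
    filter_upwards [eventually_gt_atTop (0 : ℝ)] with a' ha'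
    exact isOpen_Ioi.is_const_of_deriv_eq_zero isPreconnected_Ioi
      (fun t ht => (hkd t ht).differentiableAt.differentiableWithinAt)
      (fun t ht => (hkd t ht).deriv) ha ha'
  have hkey : k a = b * phaseDeriv F (r • e₂, e₁) (0, e₂) := by
    rcases ha.eq_or_lt with rfl | ha
    · have hcont : ContinuousAt k 0 := (hkF 0 hab).continuousAt.sub (hkN 0 hab).continuousAt
      refine tendsto_nhds_unique (hcont.tendsto.mono_left nhdsWithin_le_nhds)
        (tendsto_const_nhds.congr' ?_ : Tendsto k (𝓝[>] 0) _)
      filter_upwards [self_mem_nhdsWithin] with a ha using (hpos a ha).symm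
    · exact hpos a ha
  linarith [hkey, show k a = F (r • e₂) (a • e₁ + b • e₂) - N √(a ^ 2 + b ^ 2) from rfl]

/-- In dimension at least two, with `e₁`, `e₂` orthonormal, the formula holds with
`f(-ρ²) = F(ρ e₂, e₁)` and `r g(r) = F_y(r e₂, e₁) · e₂`. -/
lemma SatisfiesHamel.exists_formula (hH : SatisfiesHamel Ω F)
    (hsym : IsSphericallySymmetric Ω F) (hF : IsFinslerMetricOn Ω F) (hΩ : IsOpen Ω)
    (hconv : Convex ℝ Ω) (hne : Ω.Nonempty)
    (h1 : ‖e₁‖ = 1) (h2 : ‖e₂‖ = 1) (h12 : inner ℝ e₁ e₂ = (0 : ℝ)) :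
    ∃ f g : ℝ → ℝ, IsAdmissiblePair Ω f g ∧
      ∀ x ∈ Ω, ∀ y, y ≠ 0 →
        F x y = normalizedAntiderivative f ‖x‖ ‖y‖ (inner ℝ x y) + g ‖x‖ * inner ℝ x y := by
  have hS := hF.smoothOffZeroSection
  have he1 : e₁ ≠ 0 := norm_pos_iff.1 (by rw [h1]; exact one_pos)
  have hnorm : ∀ ρ : ℝ, ‖ρ • e₂‖ = |ρ| := fun ρ => by
    rw [norm_smul, h2, mul_one, Real.norm_eq_abs]
  obtain ⟨x₀, hx₀⟩ := hne
  have h0Ω : (0 : EuclideanSpace ℝ (Fin n)) ∈ Ω := hsym.mem_of_norm_le hconv hx₀ (by simp)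
  set S : Set ℝ := {ρ | ρ • e₂ ∈ Ω} with hSdef
  have hSo : IsOpen S := hΩ.preimage (by fun_prop)
  have hS0 : (0 : ℝ) ∈ S := by simpa [hSdef] using h0Ω
  have hSstar : ∀ ρ ∈ S, ∀ τ ∈ Icc (0 : ℝ) 1, τ * ρ ∈ S := by
    intro ρ hρ τ hτ
    refine hsym.mem_of_norm_le hconv hρ ?_
    rw [hnorm, hnorm, abs_mul, abs_of_nonneg hτ.1]
    exact mul_le_of_le_one_left (abs_nonneg ρ) hτ.2
  have hSneg : ∀ ρ ∈ S, -ρ ∈ S := fun ρ hρ =>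
    hsym.mem_of_norm_eq hρ (by rw [hnorm, hnorm, abs_neg])
  have hnormS : ∀ x ∈ Ω, ‖x‖ ∈ S := fun x hx =>
    hsym.mem_of_norm_eq hx (by rw [hnorm, abs_norm])
  have hray : ContDiff ℝ ∞ fun ρ : ℝ => ((ρ • e₂, e₁) :
      EuclideanSpace ℝ (Fin n) × EuclideanSpace ℝ (Fin n)) := by fun_prop
  have hrayS : MapsTo (fun ρ : ℝ => ((ρ • e₂, e₁) :
      EuclideanSpace ℝ (Fin n) × EuclideanSpace ℝ (Fin n))) S (Ω ×ˢ {0}ᶜ) := fun ρ hρ => ⟨hρ, he1⟩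
  have hP : ContDiffOn ℝ ∞ (fun ρ : ℝ => F (ρ • e₂) e₁) S :=
    ContDiffOn.comp (g := fun p : EuclideanSpace ℝ (Fin n) × EuclideanSpace ℝ (Fin n) => F p.1 p.2)
      hF.smooth hray.contDiffOn hrayS
  have hPeven : ∀ ρ ∈ S, F ((-ρ) • e₂) e₁ = F (ρ • e₂) e₁ := fun ρ hρ =>
    hsym.apply_eq (hSneg ρ hρ) (by rw [hnorm, hnorm, abs_neg]) rfl (by
      rw [real_inner_smul_left, real_inner_smul_left, real_inner_comm, h12, mul_zero, mul_zero])
  have hM : ContDiffOn ℝ ∞ (fun ρ : ℝ => phaseDeriv F (ρ • e₂, e₁) (0, e₂)) S :=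
    ((hS.contDiffOn_phaseDeriv hΩ).comp hray.contDiffOn hrayS).clm_apply contDiffOn_const
  have hM0 : phaseDeriv F ((0 : ℝ) • e₂, e₁) (0, e₂) = 0 := by
    have := hsym.phaseDeriv_rotationGenerator hS hΩ he1 h12 h0Ω he1
    rw [zero_smul]
    rwa [map_zero, rotationGenerator_apply, real_inner_self_eq_norm_sq, h1, one_pow, one_smul,
      real_inner_comm, h12, zero_smul, sub_zero] at this
  obtain ⟨g, hg, hgM⟩ := exists_contDiffOn_eq_mul hSo hSstar hM hM0
  set f : ℝ → ℝ := fun s => F (√(-s) • e₂) e₁ with hf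
  have hfsq : ∀ r : ℝ, 0 ≤ r → f (-r ^ 2) = F (r • e₂) e₁ := fun r hr => by
    simp only [hf]
    rw [neg_neg, Real.sqrt_sq hr]
  have hfsmooth : ContDiffOn ℝ ∞ f
      ((fun x : EuclideanSpace ℝ (Fin n) => -‖x‖ ^ 2) '' Ω) := by
    refine (contDiffOn_comp_sqrt_of_even hSo hS0 hSstar hSneg hP hPeven).comp
      contDiff_neg.contDiffOn ?_
    rintro _ ⟨x, hx, rfl⟩
    refine ⟨by simp, ?_⟩
    rw [neg_neg, Real.sqrt_sq (norm_nonneg x)]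
    exact hnormS x hx
  refine ⟨f, g, ⟨hfsmooth, fun x hx => ?_, hg.mono ?_⟩, fun x hx y hy => ?_⟩
  · rw [hfsq _ (norm_nonneg x)]
    exact hF.pos _ (hnormS x hx) _ he1
  · rintro _ ⟨x, hx, rfl⟩
    exact hnormS x hx
  · rcases eq_or_ne x 0 with rfl | hx0
    · rw [hsym.apply_of_orthogonal hF h1 h2 h12 h0Ω hy (inner_zero_left y), inner_zero_left,
        normalizedAntiderivative, hfsq _ (norm_nonneg _)]
      simp [hf, mul_comm]
    · have hr : 0 < ‖x‖ := norm_pos_iff.2 hx0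
      have hu : 0 < ‖y‖ := norm_pos_iff.2 hy
      have hcs := abs_real_inner_le_norm x y
      set b : ℝ := (inner ℝ x y : ℝ) / ‖x‖ with hb
      have hrb : ‖x‖ * b = inner ℝ x y := mul_div_cancel₀ _ hr.ne'
      have hbu : b ^ 2 ≤ ‖y‖ ^ 2 := by
        refine sq_le_sq.2 ?_
        rw [hb, abs_div, abs_norm, abs_norm, div_le_iff₀ hr, mul_comm]
        exact hcs
      set a : ℝ := √(‖y‖ ^ 2 - b ^ 2) with ha
      have ha2 : a ^ 2 = ‖y‖ ^ 2 - b ^ 2 := Real.sq_sqrt (by linarith)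
      have hab2 : √(a ^ 2 + b ^ 2) = ‖y‖ := by
        rw [ha2, sub_add_cancel, Real.sqrt_sq hu.le]
      have hab : a ≠ 0 ∨ b ≠ 0 := by
        by_contra! hcon
        rw [hcon.1, hcon.2] at hab2
        exact hu.ne' (by simpa using hab2.symm)
      have hxy : F x y = F (‖x‖ • e₂) (a • e₁ + b • e₂) := by
        refine hsym.apply_eq hx (by rw [hnorm, abs_norm])
          (by rw [norm_smul_add_smul_orthonormal h1 h2 h12, hab2]) ?_
        rw [real_inner_smul_left, inner_add_right, inner_smul_right, inner_smul_right,
          real_inner_comm e₁ e₂, h12, real_inner_self_eq_norm_sq, h2, mul_zero, zero_add, one_pow,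
          mul_one, hrb]
      obtain ⟨N, hNeq, hNd, hNlim⟩ :=
        exists_extension_normalizedAntiderivative_norm hsym hconv hfsmooth hx (inner ℝ x y)
      rw [← hrb] at hNd
      rw [hxy, hH.apply_orthonormal hsym hF hΩ hconv h1 h2 h12 hr (Real.sqrt_nonneg _) hab
        (hnormS x hx) (fun _ => rfl) hNd hNlim, hab2, hNeq _ hu hcs, hgM _ (hnormS x hx), ← hrb]
      ring

/-! ### Dimension at most one -/

/-- In dimension at most one, `v = ± r u`, so for `v ≠ 0` only the end point of the interval of
`u` matters, and there the constant of integration can be chosen freely. -/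
lemma exists_formula_of_le_one (hn : n ≤ 1) (hsym : IsSphericallySymmetric Ω F)
    (hF : IsFinslerMetricOn Ω F) (hconv : Convex ℝ Ω) (hne : Ω.Nonempty) :
    ∃ (f g : ℝ → ℝ) (Φ : ℝ → ℝ → ℝ → ℝ),
      IsAdmissiblePair Ω f g ∧ IsAntiderivativeInU Ω f Φ ∧
        ∀ x ∈ Ω, ∀ y, y ≠ 0 → F x y = Φ ‖x‖ ‖y‖ (inner ℝ x y) + g ‖x‖ * inner ℝ x y := by
  obtain rfl | rfl : n = 0 ∨ n = 1 := by omega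
  · refine ⟨fun _ => 1, fun _ => 0, fun _ u _ => u, ⟨contDiffOn_const, fun _ _ => one_pos,
      contDiffOn_const⟩, fun _ _ u _ _ _ => hasDerivWithinAt_id u _, fun x _ y hy => ?_⟩
    exact absurd (Subsingleton.elim y 0) hy
  · set e : EuclideanSpace ℝ (Fin 1) := EuclideanSpace.single 0 1 with he
    have hen : ‖e‖ = 1 := by simp [he]
    have he0 : e ≠ 0 := norm_pos_iff.1 (by rw [hen]; exact one_pos)
    have hcs : ∀ x y : EuclideanSpace ℝ (Fin 1), |(inner ℝ x y : ℝ)| = ‖x‖ * ‖y‖ := by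
      intro x y
      simp [EuclideanSpace.norm_eq, PiLp.inner_apply, Real.sqrt_sq_eq_abs, abs_mul, mul_comm]
    obtain ⟨x₀, hx₀⟩ := hne
    have h0Ω : (0 : EuclideanSpace ℝ (Fin 1)) ∈ Ω := hsym.mem_of_norm_le hconv hx₀ (by simp)
    set K : ℝ := F 0 e with hK
    refine ⟨fun _ => K, fun _ => 0, fun r u v => K * u +
      (if r = 0 then 0 else F (r • e) ((v / r) • e) - K * (|v| / r)),
      ⟨contDiffOn_const, fun _ _ => hF.pos 0 h0Ω e he0, contDiffOn_const⟩,
      fun x _ u v _ _ => ?_, fun x hx y hy => ?_⟩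
    · simpa using ((hasDerivWithinAt_id u _).const_mul K).add_const
        (if ‖x‖ = 0 then 0 else F (‖x‖ • e) ((v / ‖x‖) • e) - K * (|v| / ‖x‖))
    · have hu : 0 < ‖y‖ := norm_pos_iff.2 hy
      rcases eq_or_ne x 0 with rfl | hx0
      · have h1 : F 0 y = F 0 (‖y‖ • e) :=
          hsym.apply_eq h0Ω rfl (by rw [norm_smul, norm_norm, hen, mul_one]) (by simp)
        rw [h1, hF.homogeneous 0 h0Ω e _ hu]
        simp [hK, mul_comm]
      · have hr : 0 < ‖x‖ := norm_pos_iff.2 hx0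
        have h1 : F x y = F (‖x‖ • e) (((inner ℝ x y : ℝ) / ‖x‖) • e) := by
          refine hsym.apply_eq hx (by rw [norm_smul, norm_norm, hen, mul_one]) ?_ ?_
          · rw [norm_smul, hen, mul_one, norm_div, norm_norm, Real.norm_eq_abs, hcs,
              mul_div_cancel_left₀ _ hr.ne']
          · rw [real_inner_smul_left, inner_smul_right, real_inner_self_eq_norm_sq, hen, one_pow,
              mul_one, mul_div_cancel₀ _ hr.ne']
        simp only [if_neg hr.ne']
        rw [h1, hcs, mul_div_cancel_left₀ _ hr.ne']
        ring

end Formula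

/-! ### The two equivalences -/

/-- The first equivalence is for the indefinite integral, where any antiderivative is allowed.
The second one fixes the constant of integration, so that `g` carries information; it is for
`2 ≤ n`, where `|x|`, `|y|`, `⟨x, y⟩` are independent variables. -/
theorem theorem4p2 (n : ℕ) (Ω : Set (EuclideanSpace ℝ (Fin n)))
    (hΩ_open : IsOpen Ω) (hΩ_convex : Convex ℝ Ω) (hΩ_nonempty : Ω.Nonempty)
    (F : EuclideanSpace ℝ (Fin n) → EuclideanSpace ℝ (Fin n) → ℝ)
    (hF : IsFinslerMetricOn Ω F) (hF_sym : IsSphericallySymmetric Ω F) :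
    (IsProjectiveMetric Ω F ↔
      ∃ (f g : ℝ → ℝ) (Φ : ℝ → ℝ → ℝ → ℝ),
        IsAdmissiblePair Ω f g ∧ IsAntiderivativeInU Ω f Φ ∧
        ∀ x ∈ Ω, ∀ y, y ≠ 0 →
          F x y = Φ ‖x‖ ‖y‖ (inner ℝ x y) + g ‖x‖ * inner ℝ x y) ∧
    (2 ≤ n →
      (IsProjectiveMetric Ω F ↔
        ∃ f g : ℝ → ℝ, IsAdmissiblePair Ω f g ∧
          ∀ x ∈ Ω, ∀ y, y ≠ 0 →
            F x y = normalizedAntiderivative f ‖x‖ ‖y‖ (inner ℝ x y)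
              + g ‖x‖ * inner ℝ x y)) := by
  have hback : ∀ (f g : ℝ → ℝ) (Φ : ℝ → ℝ → ℝ → ℝ), IsAntiderivativeInU Ω f Φ →
      (∀ x ∈ Ω, ∀ y, y ≠ 0 → F x y = Φ ‖x‖ ‖y‖ (inner ℝ x y) + g ‖x‖ * inner ℝ x y) →
      IsProjectiveMetric Ω F := fun f g Φ hΦ hFΦ =>
    ((hasTransversalProfile_of_formula hF.smoothOffZeroSection hΩ_open hΦ hFΦ).satisfiesHamel
      hF_sym hF hΩ_open).isProjectiveMetric hF hΩ_open
  have hnorm : 2 ≤ n → IsProjectiveMetric Ω F → ∃ f g : ℝ → ℝ, IsAdmissiblePair Ω f g ∧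
      ∀ x ∈ Ω, ∀ y, y ≠ 0 →
        F x y = normalizedAntiderivative f ‖x‖ ‖y‖ (inner ℝ x y) + g ‖x‖ * inner ℝ x y := by
    intro hn hP
    refine (hP.satisfiesHamel hF hΩ_open).exists_formula hF_sym hF hΩ_open hΩ_convex hΩ_nonempty
      (e₁ := EuclideanSpace.single (⟨0, by omega⟩ : Fin n) 1)
      (e₂ := EuclideanSpace.single (⟨1, by omega⟩ : Fin n) 1) (by simp) (by simp) ?_
    simp [EuclideanSpace.inner_single_left]
  refine ⟨⟨fun hP => ?_, ?_⟩, fun hn => ⟨hnorm hn, ?_⟩⟩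
  · rcases Nat.lt_or_ge n 2 with hn | hn
    · exact exists_formula_of_le_one (by omega) hF_sym hF hΩ_convex hΩ_nonempty
    · obtain ⟨f, g, hfg, hFfg⟩ := hnorm hn hP
      exact ⟨f, g, normalizedAntiderivative f, hfg,
        isAntiderivativeInU_normalizedAntiderivative hF_sym hΩ_convex hfg.smooth_f, hFfg⟩
  · rintro ⟨f, g, Φ, -, hΦ, hFΦ⟩
    exact hback f g Φ hΦ hFΦ
  · rintro ⟨f, g, hfg, hFfg⟩
    exact hback f g _
      (isAntiderivativeInU_normalizedAntiderivative hF_sym hΩ_convex hfg.smooth_f) hFfg
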